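/- Let $H,K$ be complex Hilbert spaces and let $\mathfrak A\subseteq\mathbb B(H)$, $\mathfrak B\subseteq\mathbb B(K)$ be $C^*$-algebras of operators containing the identity operator $I$. Let $T$ be a locally compact Hausdorff space with a finite Radon measure $\mu$, and let $T=T_1\cup T_2$ with $T_1,T_2$ disjoint Borel sets. Let $f:J\to\mathbb R$ be operator convex on a real interval $J$, i.e. $f$ is continuous and $f(\lambda A+(1-\lambda)B)\le\lambda f(A)+(1-\lambda)f(B)$ for all $\lambda\in[0,1]$ and all bounded self-adjoint operators $A,B$ with spectra in $J$ on any complex Hilbert space. Let $(A_t)_{t\in T}$ be a norm continuous field of self-adjoint elements of $\mathfrak A$ with spectra in $J$, and let $(\Phi_t)_{t\in T}$ be a unital field of positive linear maps $\mathfrak A\to\mathfrak B$: $t\mapsto\Phi_t(X)$ is norm continuous for every $X\in\mathfrak A$, and $t\mapsto\Phi_t(I)$ is Bochner integrable with $\int_T\Phi_t(I)\,d\mu(t)=I$. Assume that $t\mapsto\Phi_t(A_t)$ and $t\mapsto\Phi_t(f(A_t))$ are Bochner integrable. Put $D_{T_i}=\int_{T_i}\Phi_t(I)\,d\mu(t)$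 for $i=1,2$. Each assertion below is made under the assumption that the operators whose inverses occur in it are invertible: $D_{T_1}$ and/or $D_{T_2}$, and $\Phi_t(I)$ for all $t\in T$. Then every operator to which $f$ is applied below has its spectrum in $J$, the integrand of the third expression in (i) is Bochner integrable, and the following inequalities hold. (i) $$\begin{aligned} f\Big(\int_T\Phi_t(A_t)\,d\mu(t)\Big)&\le\sum_{i=1}^2 D_{T_i}^{1/2}\,f\Big(D_{T_i}^{-1/2}\int_{T_i}\Phi_t(A_t)\,d\mu(t)\,D_{T_i}^{-1/2}\Big)D_{T_i}^{1/2}\\&\le\int_T\Phi_t(I)^{1/2}f\big(\Phi_t(I)^{-1/2}\Phi_t(A_t)\Phi_t(I)^{-1/2}\big)\Phi_t(I)^{1/2}\,d\mu(t)\\&\le\int_T\Phi_t(f(A_t))\,d\mu(t).\end{aligned}$$ (ii) $$\begin{aligned}\int_T\Phi_t(f(A_t))\,d\mu(t)-f\Big(\int_T\Phi_t(A_t)\,d\mu(t)\Big)&\ge\int_{T_1}\Phi_t(f(A_t))\,d\mu(t)-D_{T_1}^{1/2}f\Big(D_{T_1}^{-1/2}\int_{T_1}\Phi_t(A_t)\,d\mu(t)\,D_{T_1}^{-1/2}\Big)D_{T_1}^{1/2}\\&\ge0.\end{aligned}$$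 -/

import Mathlib

open MeasureTheory Set

universe v

/-- A real function `f` is operator convex on the interval `J`: it is continuous on `J`, and
`f (l A + (1 - l) B) ≤ l f(A) + (1 - l) f(B)` in the Loewner order for all bounded self-adjoint
operators `A`, `B` with spectra in `J` on every complex Hilbert space and all `l ∈ [0, 1]`.
Here `cfc f A` is the continuous functional calculus `f(A)`. -/
def OperatorConvexOn (J : Set ℝ) (f : ℝ → ℝ) : Prop :=
  J.OrdConnected ∧ ContinuousOn f J ∧
    ∀ (H : Type v) [NormedAddCommGroup H] [InnerProductSpace ℂ H] [CompleteSpace H]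
      (A B : H →L[ℂ] H), IsSelfAdjoint A → IsSelfAdjoint B →
      spectrum ℝ A ⊆ J → spectrum ℝ B ⊆ J → ∀ l ∈ Icc (0 : ℝ) 1,
        cfc f (l • A + (1 - l) • B) ≤ l • cfc f A + (1 - l) • cfc f B

section OperatorFields

variable {H K T : Type*}
  [NormedAddCommGroup H] [InnerProductSpace ℂ H] [CompleteSpace H]
  [NormedAddCommGroup K] [InnerProductSpace ℂ K] [CompleteSpace K]

/-- The operator `R^{-1/2} L R^{-1/2}`, meant for `R` strictly positive. -/
noncomputable def compress (L R : K →L[ℂ] K) : K →L[ℂ] K :=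
  R ^ (-(1 / 2) : ℝ) * L * R ^ (-(1 / 2) : ℝ)

/-- The perspective `R^{1/2} f(R^{-1/2} L R^{-1/2}) R^{1/2}` of `f`, meant for `L` self-adjoint and
`R` strictly positive. -/
noncomputable def perspective (f : ℝ → ℝ) (L R : K →L[ℂ] K) : K →L[ℂ] K :=
  R ^ (1 / 2 : ℝ) * cfc f (compress L R) * R ^ (1 / 2 : ℝ)

/-- A family `Φ t : 𝔄 → 𝔅` of positive linear maps between algebras of operators is a unital field:
`t ↦ Φ t a` is norm continuous for every `a`, and `t ↦ Φ t I` is Bochner integrable with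
integral `I`. -/
structure IsUnitalField [TopologicalSpace T] [MeasurableSpace T] (μ : Measure T)
    {𝔄 : StarSubalgebra ℂ (H →L[ℂ] H)} {𝔅 : StarSubalgebra ℂ (K →L[ℂ] K)}
    (Φ : T → 𝔄 →ₚ[ℂ] 𝔅) : Prop where
  continuous_apply : ∀ a : 𝔄, Continuous fun t => Φ t a
  integrable_one : Integrable (fun t => (Φ t 1 : K →L[ℂ] K)) μ
  integral_one : ∫ t, (Φ t 1 : K →L[ℂ] K) ∂μ = 1

/-- The integral `∫_S Φ_t(A_t) dμ(t)`, a Bochner integral in the norm topology of operators. -/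
noncomputable def fieldIntegral [MeasurableSpace T] (μ : Measure T)
    {𝔄 : StarSubalgebra ℂ (H →L[ℂ] H)} {𝔅 : StarSubalgebra ℂ (K →L[ℂ] K)}
    (Φ : T → 𝔄 →ₚ[ℂ] 𝔅) (S : Set T) (A : T → 𝔄) : K →L[ℂ] K :=
  ∫ t in S, (Φ t (A t) : K →L[ℂ] K) ∂μ

end OperatorFields

/-!
Everything rests on one statement, a Jensen inequality for a family of positive maps together with
one extra conjugation: if `C* C + ∫ Φ_t(1) dν = 1`, then
`f(C* Z C + ∫ Φ_t(A_t) dν) ≤ C* f(Z) C + ∫ Φ_t(f(A_t)) dν`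
(`OperatorConvexOn.cfc_conj_add_integral_le`).

*From finite sums.* For finitely many operators, `f(∑ C_i* X_i C_i) ≤ ∑ C_i* f(X_i) C_i` whenever
`∑ C_i* C_i = 1` (`OperatorConvexOn.finite_jensen`, the inequality of Hansen and Pedersen). The
column `V = (C_i)` is an isometry from `K` into a finite power of `K`, so the claim is that `f` of a
compression is at most the compression of `f`. With `E = 2 V V* - 1`, the mean of `X` and `E X E`
commutes with the projection `V V*`, and operator convexity of `f` applied to that mean gives it
(`OperatorConvexOn.cfc_adjoint_conj_le`).

*To integrals.* Where `A_t` has its spectrum in a compact interval `[a, b] ⊆ J`, a fine partition of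
unity `φ_i` on `[a, b]` approximates `Φ_t(A_t)` by `∑ x_i Φ_t(φ_i(A_t))` and `Φ_t(f(A_t))` by
`∑ f(x_i) Φ_t(φ_i(A_t))`, with an error controlled by `‖Φ_t(1)‖`; elsewhere both are replaced by
multiples of `Φ_t(1)`. The finite inequality holds for the integrals of these approximations, and
dominated convergence along an exhaustion of `J` by compact intervals finishes the argument. That
the limit has its spectrum in `J`, even if `J` is not closed and the spectra of the `A_t` approach
an end of `J`, follows from the norm convergence of `∫ Φ_t(1)`: a part of `T` on which the spectra
stay away from that end already carries an invertible operator
(`isUnit_conj_add_integral_of_spectrum_pos`).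

*Perspectives.* Conjugating a family by `D^{-1/2}`, where `D = ∫ Φ_t(1)`, makes it unital and gives
`perspective f (∫ Φ_t(A_t)) (∫ Φ_t(1)) ≤ ∫ Φ_t(f(A_t))`
(`OperatorConvexOn.perspective_integral_le`). With `ν` the restriction of `μ` to `T₁`, this is the
nonnegativity in (ii). With `ν` a point mass, it is the pointwise bound that gives the third
inequality of (i). With the maps `Y ↦ R_t^{1/2} Y R_t^{1/2}`, `R_t = Φ_t(1)`, it is the second
inequality of (i). The first inequality of (i) is the finite one with two terms, and the first
inequality of (ii) is the combined statement with `C = D_{T₁}^{1/2}` and the family over `T₂`. The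
integrand of the third expression of (i) is continuous, lies below `Φ_t(f(A_t))`, and above
`α Φ_t(A_t) + β Φ_t(1)` for an affine minorant `α x + β` of `f`, so it is integrable.
-/

/-! ### Intertwining relations and the finite Jensen inequality -/

theorem norm_cfc_sub_aeval_le {𝔄 : Type*} [CStarAlgebra 𝔄] {A : 𝔄} (hA : IsSelfAdjoint A)
    {s : Set ℝ} (hs : spectrum ℝ A ⊆ s) {f : ℝ → ℝ} (hf : ContinuousOn f s) {p : Polynomial ℝ}
    {ε : ℝ} (hε : 0 ≤ ε) (hp : ∀ x ∈ s, |p.eval x - f x| ≤ ε) :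
    ‖cfc f A - Polynomial.aeval A p‖ ≤ ε := by
  rw [← cfc_polynomial p A hA, ← cfc_sub f _ A (hf.mono hs) (by fun_prop)]
  refine norm_cfc_le hε fun x hx => ?_
  rw [Real.norm_eq_abs, abs_sub_comm]
  exact hp x (hs hx)

section Intertwining

open ContinuousLinearMap

/-- An intertwiner of two self-adjoint operators intertwines their continuous functional calculi:
it holds for polynomials, hence for uniform limits of polynomials. -/
theorem cfc_comp_eq_comp_cfc {K L : Type*}
    [NormedAddCommGroup K] [InnerProductSpace ℂ K] [CompleteSpace K]
    [NormedAddCommGroup L] [InnerProductSpace ℂ L] [CompleteSpace L]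
    {A : L →L[ℂ] L} {B : K →L[ℂ] K} {V : K →L[ℂ] L} (hA : IsSelfAdjoint A) (hB : IsSelfAdjoint B)
    {a b : ℝ} (hAs : spectrum ℝ A ⊆ Icc a b) (hBs : spectrum ℝ B ⊆ Icc a b)
    {f : ℝ → ℝ} (hf : ContinuousOn f (Icc a b)) (h : A ∘L V = V ∘L B) :
    cfc f A ∘L V = V ∘L cfc f B := by
  have hpow : ∀ n : ℕ, (A ^ n) ∘L V = V ∘L (B ^ n) := by
    intro n
    induction n with
    | zero => ext x; simp
    | succ n ih =>
      rw [pow_succ, pow_succ', mul_def, mul_def, comp_assoc, h, ← comp_assoc, ih, comp_assoc]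
      rw [← mul_def, ← mul_def, ← pow_succ, ← pow_succ']
  have hpoly : ∀ p : Polynomial ℝ, (Polynomial.aeval A p) ∘L V = V ∘L (Polynomial.aeval B p) := by
    intro p
    induction p using Polynomial.induction_on' with
    | add p q hp hq => rw [map_add, map_add, add_comp, comp_add, hp, hq]
    | monomial n c =>
      rw [Polynomial.aeval_monomial, Polynomial.aeval_monomial, ← Algebra.smul_def,
        ← Algebra.smul_def, smul_comp, hpow]
      ext x
      simp
  have happrox : ∀ ε > 0, ‖cfc f A ∘L V - V ∘L cfc f B‖ ≤ ε * (2 * ‖V‖) := by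
    intro ε hε
    obtain ⟨p, hp⟩ := exists_polynomial_near_of_continuousOn a b f hf ε hε
    have e : cfc f A ∘L V - V ∘L cfc f B =
        (cfc f A - Polynomial.aeval A p) ∘L V - V ∘L (cfc f B - Polynomial.aeval B p) := by
      rw [sub_comp, comp_sub, hpoly p]; abel
    rw [e]
    refine (norm_sub_le _ _).trans ?_
    refine (add_le_add (opNorm_comp_le _ _) (opNorm_comp_le _ _)).trans ?_
    have hA' := norm_cfc_sub_aeval_le hA hAs hf hε.le fun x hx => (hp x hx).le
    have hB' := norm_cfc_sub_aeval_le hB hBs hf hε.le fun x hx => (hp x hx).le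
    nlinarith [norm_nonneg V]
  rw [← sub_eq_zero, ← norm_le_zero_iff]
  refine le_of_forall_pos_le_add fun δ hδ => ?_
  have hV : 0 < 2 * ‖V‖ + 1 := by positivity
  refine (happrox (δ / (2 * ‖V‖ + 1)) (by positivity)).trans ?_
  rw [zero_add, div_mul_eq_mul_div, div_le_iff₀ hV]
  nlinarith [norm_nonneg V]

end Intertwining

theorem spectrum_subset_Icc_iff {𝔄 : Type*} [CStarAlgebra 𝔄] [PartialOrder 𝔄] [StarOrderedRing 𝔄]
    {A : 𝔄} (hA : IsSelfAdjoint A) {a b : ℝ} :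
    spectrum ℝ A ⊆ Icc a b ↔ algebraMap ℝ 𝔄 a ≤ A ∧ A ≤ algebraMap ℝ 𝔄 b := by
  rw [algebraMap_le_iff_le_spectrum, le_algebraMap_iff_spectrum_le]
  exact ⟨fun h => ⟨fun x hx => (h hx).1, fun x hx => (h hx).2⟩, fun h x hx => ⟨h.1 x hx, h.2 x hx⟩⟩

theorem exists_Icc_of_isCompact_subset {s J : Set ℝ} (hs : IsCompact s)
    (hJ : J.OrdConnected) (hJne : J.Nonempty) (hsJ : s ⊆ J) :
    ∃ a b, a ≤ b ∧ Icc a b ⊆ J ∧ s ⊆ Icc a b := by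
  rcases s.eq_empty_or_nonempty with h | h
  · obtain ⟨x, hx⟩ := hJne
    exact ⟨x, x, le_rfl, by simpa using hx, by simp [h]⟩
  · obtain ⟨a, ha, ha'⟩ := hs.exists_isLeast h
    obtain ⟨b, hb, hb'⟩ := hs.exists_isGreatest h
    exact ⟨a, b, ha' hb, hJ.out (hsJ ha) (hsJ hb), fun x hx => ⟨ha' hx, hb' hx⟩⟩

section Finite
variable {K : Type v} [NormedAddCommGroup K] [InnerProductSpace ℂ K] [CompleteSpace K]

open ContinuousLinearMap

/-- The coordinate embeddings of `K` into the Hilbert sum of `ι` copies of `K`, which lies in the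
same universe as `K`. -/
theorem exists_orthogonal_isometries (ι : Type) [Fintype ι] [DecidableEq ι] (K : Type v)
    [NormedAddCommGroup K] [InnerProductSpace ℂ K] [CompleteSpace K] :
    ∃ (L : Type v) (_ : NormedAddCommGroup L) (_ : InnerProductSpace ℂ L) (_ : CompleteSpace L)
      (E : ι → K →L[ℂ] L),
      (∀ i j, adjoint (E i) ∘L E j = if i = j then .id ℂ K else 0) ∧
        ∑ i, E i ∘L adjoint (E i) = .id ℂ L := by
  let L := PiLp 2 fun _ : ι => K
  let E : ι → K →L[ℂ] L := fun i =>
    (PiLp.continuousLinearEquiv 2 ℂ fun _ : ι => K).symm.toContinuousLinearMap ∘L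
      ContinuousLinearMap.single ℂ (fun _ : ι => K) i
  have hE : ∀ i x, E i x = PiLp.single 2 i x := fun i x => rfl
  have hadj : ∀ i, adjoint (E i) = PiLp.proj 2 (fun _ : ι => K) i := by
    intro i
    symm
    rw [eq_adjoint_iff]
    intro x y
    rw [hE, PiLp.inner_apply, Finset.sum_eq_single i]
    · simp
    · intro j _ hj
      rw [PiLp.single_eq_of_ne _ hj, inner_zero_right]
    · simp
  refine ⟨L, inferInstance, inferInstance, inferInstance, E, fun i j => ?_, ?_⟩
  · ext x
    rw [hadj, comp_apply, hE, PiLp.proj_apply]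
    split_ifs with h
    · subst h; simp
    · rw [PiLp.single_eq_of_ne _ h]; simp
  · ext x j
    rw [sum_apply, WithLp.ofLp_sum, Finset.sum_apply, Finset.sum_eq_single j]
    · simp [hadj, hE]
      rfl
    · intro i _ hi
      rw [comp_apply, hE, PiLp.single_eq_of_ne _ hi.symm]
    · simp

/-- Compressing by an isometry does not enlarge an interval containing the spectrum. -/
theorem spectrum_adjoint_conj_subset {L : Type*} [NormedAddCommGroup L] [InnerProductSpace ℂ L]
    [CompleteSpace L] {X : L →L[ℂ] L} (hX : IsSelfAdjoint X) {a b : ℝ}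
    (hXs : spectrum ℝ X ⊆ Icc a b) {V : K →L[ℂ] L} (hV : adjoint V ∘L V = 1) :
    IsSelfAdjoint (adjoint V ∘L X ∘L V) ∧ spectrum ℝ (adjoint V ∘L X ∘L V) ⊆ Icc a b := by
  have hsa : IsSelfAdjoint (adjoint V ∘L X ∘L V) := hX.adjoint_conj V
  have hV' : ∀ x, adjoint V (V x) = x := fun x => by
    simpa using congrArg (fun D : K →L[ℂ] K => D x) hV
  refine ⟨hsa, ?_⟩
  rw [spectrum_subset_Icc_iff hX] at hXs
  rw [spectrum_subset_Icc_iff hsa]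
  obtain ⟨h1, h2⟩ := hXs
  rw [le_def] at h1 h2 ⊢
  rw [le_def]
  have e1 := h1.adjoint_conj V
  have e2 := h2.adjoint_conj V
  constructor
  · convert e1 using 1
    ext x
    simp [Algebra.algebraMap_eq_smul_one, hV']
  · convert e2 using 1
    ext x
    simp [Algebra.algebraMap_eq_smul_one, hV']

theorem spectrum_convex_comb_subset {𝔄 : Type*} [CStarAlgebra 𝔄] [PartialOrder 𝔄]
    [StarOrderedRing 𝔄] {X Y : 𝔄} (hX : IsSelfAdjoint X)
    (hY : IsSelfAdjoint Y) {a b : ℝ} (hXs : spectrum ℝ X ⊆ Icc a b) (hYs : spectrum ℝ Y ⊆ Icc a b)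
    {l : ℝ} (hl : l ∈ Icc (0 : ℝ) 1) :
    IsSelfAdjoint (l • X + (1 - l) • Y) ∧ spectrum ℝ (l • X + (1 - l) • Y) ⊆ Icc a b := by
  have hsa : IsSelfAdjoint (l • X + (1 - l) • Y) :=
    ((IsSelfAdjoint.all l).smul hX).add ((IsSelfAdjoint.all (1 - l)).smul hY)
  refine ⟨hsa, ?_⟩
  rw [spectrum_subset_Icc_iff hX] at hXs
  rw [spectrum_subset_Icc_iff hY] at hYs
  rw [spectrum_subset_Icc_iff hsa]
  have e : ∀ c : 𝔄, c = l • c + (1 - l) • c := fun c => by module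
  have h1l : 0 ≤ 1 - l := sub_nonneg.2 hl.2
  constructor
  · rw [e (algebraMap ℝ _ a)]
    exact add_le_add (smul_le_smul_of_nonneg_left hXs.1 hl.1)
      (smul_le_smul_of_nonneg_left hYs.1 h1l)
  · rw [e (algebraMap ℝ _ b)]
    exact add_le_add (smul_le_smul_of_nonneg_left hXs.2 hl.1)
      (smul_le_smul_of_nonneg_left hYs.2 h1l)

/-- For an isometry `V`, `f(V* X V) ≤ V* f(X) V`. The reflection `E = 2 V V* - 1` fixes the range
of `V`, so `(X + E X E) / 2` has the same compression as `X` and maps the range of `V` to itself. -/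
theorem OperatorConvexOn.cfc_adjoint_conj_le {J : Set ℝ} {f : ℝ → ℝ}
    (hf : OperatorConvexOn.{v} J f) {L : Type v} [NormedAddCommGroup L] [InnerProductSpace ℂ L]
    [CompleteSpace L] {X : L →L[ℂ] L} (hX : IsSelfAdjoint X) {a b : ℝ} (hab : Icc a b ⊆ J)
    (hXs : spectrum ℝ X ⊆ Icc a b) {V : K →L[ℂ] L} (hV : adjoint V ∘L V = 1) :
    cfc f (adjoint V ∘L X ∘L V) ≤ adjoint V ∘L cfc f X ∘L V := by
  obtain ⟨-, hfc, hconv⟩ := hf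
  replace hfc := hfc.mono hab
  have hV' : ∀ x, adjoint V (V x) = x := fun x => by
    simpa using congrArg (fun D : K →L[ℂ] K => D x) hV
  obtain ⟨E, hE⟩ : ∃ E : L →L[ℂ] L, E = (2 : ℝ) • (V ∘L adjoint V) - 1 := ⟨_, rfl⟩
  have hEa : adjoint E = E := by
    rw [← star_eq_adjoint, hE, star_sub, star_smul, star_one, star_eq_adjoint, adjoint_comp,
      adjoint_adjoint, star_trivial]
  have hEV : E ∘L V = V := by
    ext x
    simp only [hE, comp_apply, sub_apply, smul_apply, hV', one_apply_eq_self]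
    module
  have hVE : adjoint V ∘L E = adjoint V := by
    simpa [adjoint_comp, hEa] using congrArg adjoint hEV
  have hEE : E ∘L E = 1 := by
    nth_rw 2 [hE]
    ext x
    have h := congrArg (fun D : K →L[ℂ] L => D (adjoint V x)) hEV
    simp only [comp_apply] at h
    simp only [comp_apply, sub_apply, smul_apply, one_apply_eq_self, map_sub, map_smul_of_tower, h]
    simp only [hE, comp_apply, sub_apply, smul_apply, one_apply_eq_self]
    module
  obtain ⟨hY, hYs⟩ := spectrum_adjoint_conj_subset hX hXs (V := E) (by rw [hEa, hEE])
  rw [hEa] at hY hYs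
  obtain ⟨hW, hWs⟩ := spectrum_adjoint_conj_subset hX hXs hV
  have hhalf : (1 / 2 : ℝ) ∈ Icc (0 : ℝ) 1 := by norm_num
  obtain ⟨hZ, hZs⟩ := spectrum_convex_comb_subset hX hY hXs hYs hhalf
  have key := hconv L X (E ∘L X ∘L E) hX hY (hXs.trans hab) (hYs.trans hab) _ hhalf
  have hfY : cfc f (E ∘L X ∘L E) = E ∘L cfc f X ∘L E := by
    have h := cfc_comp_eq_comp_cfc (V := E) hY hX hYs hXs hfc
      (by rw [comp_assoc, comp_assoc, hEE]; rfl)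
    calc cfc f (E ∘L X ∘L E) = (cfc f (E ∘L X ∘L E) ∘L E) ∘L E := by
          rw [comp_assoc, hEE]; rfl
      _ = _ := by rw [h, comp_assoc]
  have hfZ : cfc f ((1 / 2 : ℝ) • X + (1 - 1 / 2 : ℝ) • (E ∘L X ∘L E)) ∘L V =
      V ∘L cfc f (adjoint V ∘L X ∘L V) := by
    refine cfc_comp_eq_comp_cfc hZ hW hZs hWs hfc ?_
    ext x
    have h := congrArg (fun D : K →L[ℂ] L => D x) hEV
    simp only [comp_apply] at h
    simp only [comp_apply, add_apply, smul_apply, h]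
    simp only [hE, comp_apply, sub_apply, smul_apply, one_apply_eq_self]
    module
  rw [le_def] at key ⊢
  have key' := key.adjoint_conj V
  convert key' using 1
  have e1 : adjoint V ∘L cfc f ((1 / 2 : ℝ) • X + (1 - 1 / 2 : ℝ) • (E ∘L X ∘L E)) ∘L V =
      cfc f (adjoint V ∘L X ∘L V) := by
    rw [hfZ, ← comp_assoc, hV]; rfl
  have e2 : adjoint V ∘L (E ∘L cfc f X ∘L E) ∘L V = adjoint V ∘L cfc f X ∘L V := by
    rw [comp_assoc, comp_assoc, hEV, ← comp_assoc, hVE]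
  rw [sub_comp, comp_sub, e1, hfY, add_comp, comp_add, smul_comp, smul_comp, comp_smul, comp_smul,
    e2]
  module

/-- The Jensen operator inequality of Hansen and Pedersen, together with the fact that `f` is
applied within `J`. -/
theorem OperatorConvexOn.finite_jensen {J : Set ℝ} {f : ℝ → ℝ}
    (hf : OperatorConvexOn.{v} J f) {ι : Type} [Fintype ι] {C X : ι → K →L[ℂ] K}
    (hX : ∀ i, IsSelfAdjoint (X i)) (hXJ : ∀ i, spectrum ℝ (X i) ⊆ J)
    (hC : ∑ i, star (C i) * C i = 1) :
    spectrum ℝ (∑ i, star (C i) * X i * C i) ⊆ J ∧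
      cfc f (∑ i, star (C i) * X i * C i) ≤ ∑ i, star (C i) * cfc f (X i) * C i := by
  classical
  rcases subsingleton_or_nontrivial (K →L[ℂ] K) with hK | hK
  · exact ⟨by rw [spectrum.of_subsingleton]; exact empty_subset _, (Subsingleton.elim _ _).le⟩
  have hι : Nonempty ι := by
    by_contra h
    rw [not_nonempty_iff] at h
    simp at hC
  obtain ⟨i₀⟩ := hι
  have hJne : J.Nonempty := (ContinuousFunctionalCalculus.spectrum_nonempty (R := ℝ) (X i₀)
    (hX i₀)).mono (hXJ i₀)
  obtain ⟨a, b, hab, habJ, hXs⟩ := exists_Icc_of_isCompact_subset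
    (isCompact_iUnion fun i => spectrum.isCompact (X i)) hf.1 hJne (iUnion_subset hXJ)
  rw [iUnion_subset_iff] at hXs
  obtain ⟨L, _, _, _, E, hE, hE1⟩ := exists_orthogonal_isometries ι K
  have hEE : ∀ i, adjoint (E i) ∘L E i = 1 := fun i => by rw [hE, if_pos rfl]; rfl
  obtain ⟨V, hVdef⟩ : ∃ V : K →L[ℂ] L, V = ∑ i, E i ∘L C i := ⟨_, rfl⟩
  obtain ⟨D, hDdef⟩ : ∃ D : L →L[ℂ] L, D = ∑ i, E i ∘L X i ∘L adjoint (E i) := ⟨_, rfl⟩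
  have hEV : ∀ i, adjoint (E i) ∘L V = C i := by
    intro i
    rw [hVdef, comp_finsetSum, Finset.sum_eq_single i]
    · rw [← comp_assoc, hEE]; rfl
    · intro j _ hj
      rw [← comp_assoc, hE, if_neg hj.symm, zero_comp]
    · simp
  have hVadj : adjoint V = ∑ i, star (C i) ∘L adjoint (E i) := by
    rw [hVdef, map_sum]
    exact Finset.sum_congr rfl fun i _ => adjoint_comp _ _
  have hV : adjoint V ∘L V = 1 := by
    rw [hVadj, finsetSum_comp, ← hC]
    exact Finset.sum_congr rfl fun i _ => by rw [comp_assoc, hEV]; rfl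
  have hD : IsSelfAdjoint D := by
    rw [hDdef]
    exact isSelfAdjoint_sum _ fun i _ => (hX i).conj_adjoint (E i)
  have hDs : spectrum ℝ D ⊆ Icc a b := by
    have halg : ∀ c : ℝ, algebraMap ℝ (L →L[ℂ] L) c =
        ∑ i, E i ∘L algebraMap ℝ (K →L[ℂ] K) c ∘L adjoint (E i) := by
      intro c
      have : algebraMap ℝ (L →L[ℂ] L) c = c • ∑ i, E i ∘L adjoint (E i) := by
        rw [hE1, Algebra.algebraMap_eq_smul_one]; rfl
      rw [this, Finset.smul_sum]
      refine Finset.sum_congr rfl fun i _ => ?_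
      ext x
      simp [Algebra.algebraMap_eq_smul_one]
    rw [spectrum_subset_Icc_iff hD, halg, halg, hDdef]
    refine ⟨Finset.sum_le_sum fun i _ => ?_, Finset.sum_le_sum fun i _ => ?_⟩
    · have h := ((spectrum_subset_Icc_iff (hX i)).1 (hXs i)).1
      rw [le_def] at h ⊢
      simpa [sub_comp, comp_sub] using h.conj_adjoint (E i)
    · have h := ((spectrum_subset_Icc_iff (hX i)).1 (hXs i)).2
      rw [le_def] at h ⊢
      simpa [sub_comp, comp_sub] using h.conj_adjoint (E i)
  have hDE : ∀ i, D ∘L E i = E i ∘L X i := by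
    intro i
    rw [hDdef, finsetSum_comp, Finset.sum_eq_single i]
    · rw [comp_assoc, comp_assoc, hEE]; rfl
    · intro j _ hj
      rw [comp_assoc, comp_assoc, hE, if_neg hj, comp_zero, comp_zero]
    · simp
  have hfDE : ∀ i, cfc f D ∘L E i = E i ∘L cfc f (X i) := fun i =>
    cfc_comp_eq_comp_cfc hD (hX i) hDs (hXs i) (hf.2.1.mono habJ) (hDE i)
  have hconj : ∀ (F : L →L[ℂ] L) (Y : ι → K →L[ℂ] K), (∀ i, F ∘L E i = E i ∘L Y i) →
      adjoint V ∘L F ∘L V = ∑ i, star (C i) * Y i * C i := by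
    intro F Y hF
    have : F ∘L V = ∑ i, E i ∘L Y i ∘L C i := by
      rw [hVdef, comp_finsetSum]
      exact Finset.sum_congr rfl fun i _ => by rw [← comp_assoc, hF, comp_assoc]
    rw [this, comp_finsetSum]
    refine Finset.sum_congr rfl fun i _ => ?_
    have h : adjoint V ∘L E i = star (C i) := by
      rw [star_eq_adjoint, ← hEV i, adjoint_comp, adjoint_adjoint]
    rw [← comp_assoc, h, mul_assoc]; rfl
  rw [← hconj D X hDE, ← hconj _ _ hfDE]
  exact ⟨(spectrum_adjoint_conj_subset hD hDs hV).2.trans habJ,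
    hf.cfc_adjoint_conj_le hD habJ hDs hV⟩

/-- The Jensen operator inequality with one general term `C* Z C` and otherwise scalar operators
`x i`, for which only the weights `M i = C_i* C_i` matter. -/
theorem OperatorConvexOn.jensen_add_sum {J : Set ℝ} {f : ℝ → ℝ}
    (hf : OperatorConvexOn.{v} J f) {ι : Type} [Fintype ι] {C Z : K →L[ℂ] K}
    (hZ : IsSelfAdjoint Z) (hZJ : spectrum ℝ Z ⊆ J) {M : ι → K →L[ℂ] K} {x : ι → ℝ}
    (hM : ∀ i, 0 ≤ M i) (hx : ∀ i, x i ∈ J) (hsum : star C * C + ∑ i, M i = 1) :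
    spectrum ℝ (star C * Z * C + ∑ i, x i • M i) ⊆ J ∧
      cfc f (star C * Z * C + ∑ i, x i • M i) ≤
        star C * cfc f Z * C + ∑ i, f (x i) • M i := by
  rcases subsingleton_or_nontrivial (K →L[ℂ] K) with hK | hK
  · exact ⟨by rw [spectrum.of_subsingleton]; exact empty_subset _, (Subsingleton.elim _ _).le⟩
  have hsq : ∀ i, star (CFC.sqrt (M i)) * CFC.sqrt (M i) = M i := fun i => by
    rw [(IsSelfAdjoint.of_nonneg (CFC.sqrt_nonneg (M i))).star_eq, CFC.sqrt_mul_sqrt_self _ (hM i)]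
  have h := hf.finite_jensen (ι := Option ι)
    (C := fun o => o.elim C fun i => CFC.sqrt (M i))
    (X := fun o => o.elim Z fun i => algebraMap ℝ _ (x i)) ?_ ?_ ?_
  · have e : ∀ (c : ℝ) i, star (CFC.sqrt (M i)) * algebraMap ℝ (K →L[ℂ] K) c * CFC.sqrt (M i) =
        c • M i := fun c i => by
      rw [← Algebra.commutes, mul_assoc, hsq, Algebra.smul_def]
    simpa only [Fintype.sum_option, Option.elim, cfc_algebraMap, e] using h
  · rintro (_ | i)
    · exact hZ
    · exact IsSelfAdjoint.algebraMap _ (IsSelfAdjoint.all _)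
  · rintro (_ | i)
    · exact hZJ
    · simpa [spectrum.scalar_eq] using hx i
  · simpa [Fintype.sum_option, hsq] using hsum

end Finite

/-! ### Approximation tools on the interval and for positive maps -/

open Filter Topology

/-- A compact subinterval of an interval `J` has a compact neighbourhood relative to `J`. It may
contain an endpoint of `J`, so that it need not be a neighbourhood in `ℝ`. -/
theorem exists_isOpen_inter_subset_isCompact {J : Set ℝ} (hJ : J.OrdConnected) {p q : ℝ}
    (hpq : p ≤ q) (h : Icc p q ⊆ J) :
    ∃ U s : Set ℝ, IsOpen U ∧ IsCompact s ∧ Icc p q ⊆ U ∧ U ∩ J ⊆ s ∧ s ⊆ J := by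
  have hp : p ∈ J := h ⟨le_rfl, hpq⟩
  have hq : q ∈ J := h ⟨hpq, le_rfl⟩
  obtain ⟨p', V, hp', hV, hpV, hVJ⟩ : ∃ (p' : ℝ) (V : Set ℝ), p' ∈ J ∧ IsOpen V ∧ Ici p ⊆ V ∧
      ∀ x ∈ V ∩ J, p' ≤ x := by
    by_cases hx : ∃ x ∈ J, x < p
    · obtain ⟨x, hxJ, hxp⟩ := hx
      exact ⟨x, Ioi x, hxJ, isOpen_Ioi, fun y hy => lt_of_lt_of_le hxp hy, fun y hy => hy.1.le⟩
    · push Not at hx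
      exact ⟨p, univ, hp, isOpen_univ, subset_univ _, fun y hy => hx y hy.2⟩
  obtain ⟨q', W, hq', hW, hqW, hWJ⟩ : ∃ (q' : ℝ) (W : Set ℝ), q' ∈ J ∧ IsOpen W ∧ Iic q ⊆ W ∧
      ∀ x ∈ W ∩ J, x ≤ q' := by
    by_cases hx : ∃ x ∈ J, q < x
    · obtain ⟨x, hxJ, hxp⟩ := hx
      exact ⟨x, Iio x, hxJ, isOpen_Iio, fun y hy => lt_of_le_of_lt hy hxp, fun y hy => hy.1.le⟩
    · push Not at hx
      exact ⟨q, univ, hq, isOpen_univ, subset_univ _, fun y hy => hx y hy.2⟩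
  exact ⟨V ∩ W, Icc p' q', hV.inter hW, isCompact_Icc,
    fun y hy => ⟨hpV hy.1, hqW hy.2⟩, fun y hy => ⟨hVJ y ⟨hy.1.1, hy.2⟩, hWJ y ⟨hy.1.2, hy.2⟩⟩,
    hJ.out hp' hq'⟩

/-- Continuity of `A ↦ f(A)` on the self-adjoint elements with spectrum in an interval `J`, which
need be neither compact nor a neighbourhood of the spectra. -/
theorem tendsto_cfc_of_spectrum_subset {𝔄 : Type*} [CStarAlgebra 𝔄] {J : Set ℝ}
    (hJ : J.OrdConnected) {f : ℝ → ℝ} (hf : ContinuousOn f J) {X : Type*} {l : Filter X}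
    {A : X → 𝔄} {A₀ : 𝔄} (h : Tendsto A l (𝓝 A₀)) (hA : ∀ x, IsSelfAdjoint (A x))
    (hAJ : ∀ x, spectrum ℝ (A x) ⊆ J) (hA₀ : IsSelfAdjoint A₀) (hA₀J : spectrum ℝ A₀ ⊆ J) :
    Tendsto (fun x => cfc f (A x)) l (𝓝 (cfc f A₀)) := by
  rcases subsingleton_or_nontrivial 𝔄 with h𝔄 | h𝔄
  · rw [Subsingleton.elim (fun x => cfc f (A x)) fun _ => cfc f A₀]
    exact tendsto_const_nhds
  have hJne : J.Nonempty :=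
    (ContinuousFunctionalCalculus.spectrum_nonempty (R := ℝ) A₀ hA₀).mono hA₀J
  obtain ⟨p, q, hpq, hpqJ, hs⟩ :=
    exists_Icc_of_isCompact_subset (spectrum.isCompact A₀) hJ hJne hA₀J
  obtain ⟨U, s, hU, hsc, hpU, hUs, hsJ⟩ := exists_isOpen_inter_subset_isCompact hJ hpq hpqJ
  refine h.cfc hsc f ?_ (Eventually.of_forall hA)
    (fun x hx => hUs ⟨hpU (hs hx), hA₀J hx⟩) hA₀ (hf.mono hsJ)
  have := (upperHemicontinuous_spectrum ℝ 𝔄).upperHemicontinuousAt A₀ U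
    (hU.mem_nhdsSet.2 (hs.trans hpU))
  filter_upwards [h.eventually this] with x hx y hy
  exact hUs ⟨subset_of_mem_nhdsSet hx hy, hAJ x hy⟩

theorem exists_seq_Icc_exhausting {J : Set ℝ} (hJ : J.OrdConnected) (hJne : J.Nonempty) :
    ∃ a b : ℕ → ℝ, (∀ n, a n ≤ b n) ∧ (∀ n, Icc (a n) (b n) ⊆ J) ∧
      ∀ c ∈ J, ∀ d ∈ J, ∀ᶠ n in atTop, Icc c d ⊆ Icc (a n) (b n) := by
  obtain ⟨x, hx⟩ := hJne
  have : Nonempty J := ⟨⟨x, hx⟩⟩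
  obtain ⟨p, hp⟩ := exists_seq_tendsto (atBot : Filter J)
  obtain ⟨q, hq⟩ := exists_seq_tendsto (atTop : Filter J)
  refine ⟨fun n => min (p n) x, fun n => max (q n) x,
    fun n => (min_le_right _ _).trans (le_max_right _ _), fun n => hJ.out ?_ ?_, ?_⟩
  · change min (p n : ℝ) x ∈ J
    rcases min_choice (p n : ℝ) x with h | h <;> rw [h]
    exacts [(p n).2, hx]
  · change max (q n : ℝ) x ∈ J
    rcases max_choice (q n : ℝ) x with h | h <;> rw [h]
    exacts [(q n).2, hx]
  · intro c hc d hd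
    filter_upwards [hp.eventually (eventually_le_atBot ⟨c, hc⟩),
      hq.eventually (eventually_ge_atTop ⟨d, hd⟩)] with n h1 h2
    exact Icc_subset_Icc ((min_le_left _ _).trans h1) (le_trans h2 (le_max_left _ _))

/-- A partition of unity on `[a, b]`, with nodes in `[a, b]`, for which the interpolants of both
the identity and `f` at the nodes are within `ε`. -/
theorem exists_partition_approx {a b : ℝ} {f : ℝ → ℝ} (hf : ContinuousOn f (Icc a b)) {ε : ℝ}
    (hε : 0 < ε) :
    ∃ (m : ℕ) (x : Fin m → ℝ) (φ : Fin m → C(ℝ, ℝ)), (∀ i, x i ∈ Icc a b) ∧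
      (∀ i y, 0 ≤ φ i y) ∧ (∀ y ∈ Icc a b, ∑ i, φ i y = 1) ∧
      ∀ y ∈ Icc a b, |y - ∑ i, x i * φ i y| ≤ ε ∧ |f y - ∑ i, f (x i) * φ i y| ≤ ε := by
  obtain ⟨δ, hδ, hδf⟩ := Metric.uniformContinuousOn_iff.1
    (isCompact_Icc.uniformContinuousOn_of_continuous hf) ε hε
  obtain ⟨t, hts, htf, hcov⟩ :=
    (isCompact_Icc (a := a) (b := b)).finite_cover_balls (lt_min hδ hε)
  obtain ⟨m, x, -, hx⟩ := htf.fin_param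
  have hxm : ∀ i, x i ∈ Icc a b := fun i => hts (hx ▸ mem_range_self i)
  have hcov' : Icc a b ⊆ ⋃ i, Metric.ball (x i) (min δ ε) := by
    intro y hy
    obtain ⟨z, hz, hyz⟩ := mem_iUnion₂.1 (hcov hy)
    rw [← hx] at hz
    obtain ⟨i, rfl⟩ := hz
    exact mem_iUnion.2 ⟨i, hyz⟩
  obtain ⟨φ, hφs, hφ1, hφ, -⟩ := exists_continuous_sum_one_of_isOpen_isCompact
    (fun i => Metric.isOpen_ball) isCompact_Icc hcov'
  have hsum : ∀ y ∈ Icc a b, ∑ i, φ i y = 1 := fun y hy => by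
    simpa using hφ1 hy
  have key : ∀ (g : ℝ → ℝ), ∀ y ∈ Icc a b,
      (∀ z ∈ Icc a b, dist y z < min δ ε → dist (g y) (g z) ≤ ε) →
      |g y - ∑ i, g (x i) * φ i y| ≤ ε := by
    intro g y hy hg
    have e : g y - ∑ i, g (x i) * φ i y = ∑ i, φ i y * (g y - g (x i)) := by
      simp only [mul_sub, Finset.sum_sub_distrib, ← Finset.sum_mul, hsum y hy, one_mul]
      congr 1
      exact Finset.sum_congr rfl fun i _ => mul_comm _ _
    rw [e]
    refine (Finset.abs_sum_le_sum_abs _ _).trans ?_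
    calc ∑ i, |φ i y * (g y - g (x i))| ≤ ∑ i, φ i y * ε := by
          refine Finset.sum_le_sum fun i _ => ?_
          rw [abs_mul, abs_of_nonneg (hφ i y).1]
          by_cases h0 : φ i y = 0
          · simp [h0]
          · have := hφs i (subset_tsupport _ h0)
            exact mul_le_mul_of_nonneg_left (hg _ (hxm i) this) (hφ i y).1
      _ = ε := by rw [← Finset.sum_mul, hsum y hy, one_mul]
  refine ⟨m, x, φ, hxm, fun i y => (hφ i y).1, hsum, fun y hy => ⟨?_, ?_⟩⟩
  · exact key id y hy fun z _ hz => (hz.trans_le (min_le_right _ _)).le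
  · exact key f y hy fun z hz hyz => (hδf y hy z hz (hyz.trans_le (min_le_left _ _))).le

theorem norm_le_norm_of_neg_le_of_le {𝔅 : Type*} [CStarAlgebra 𝔅] [PartialOrder 𝔅]
    [StarOrderedRing 𝔅] {a b : 𝔅} (ha : IsSelfAdjoint a) (h₁ : -b ≤ a) (h₂ : a ≤ b) :
    ‖a‖ ≤ ‖b‖ := by
  have hb : IsSelfAdjoint b := by
    have := (IsSelfAdjoint.of_nonneg (sub_nonneg.2 h₂)).add ha
    simpa using this
  have h3 : b ≤ algebraMap ℝ 𝔅 ‖b‖ := hb.le_algebraMap_norm_self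
  have hs : spectrum ℝ a ⊆ Icc (-‖b‖) ‖b‖ := by
    rw [spectrum_subset_Icc_iff ha, map_neg]
    exact ⟨(neg_le_neg h3).trans h₁, h₂.trans h3⟩
  rw [← cfc_id ℝ a]
  exact norm_cfc_le (norm_nonneg _) fun x hx => abs_le.2 (hs hx)

theorem PositiveLinearMap.map_algebraMap_real {𝔄 𝔅 : Type*} [CStarAlgebra 𝔄] [PartialOrder 𝔄]
    [CStarAlgebra 𝔅] [PartialOrder 𝔅] (Φ : 𝔄 →ₚ[ℂ] 𝔅) (r : ℝ) :
    Φ (algebraMap ℝ 𝔄 r) = r • Φ 1 := by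
  rw [Algebra.algebraMap_eq_smul_one, Φ.map_smul_of_tower]

section PositiveMap

variable {𝔄 𝔅 : Type*} [CStarAlgebra 𝔄] [PartialOrder 𝔄] [StarOrderedRing 𝔄]
  [CStarAlgebra 𝔅] [PartialOrder 𝔅] [StarOrderedRing 𝔅]

theorem PositiveLinearMap.map_isSelfAdjoint (Φ : 𝔄 →ₚ[ℂ] 𝔅) {X : 𝔄} (hX : IsSelfAdjoint X) :
    IsSelfAdjoint (Φ X) := by
  have h1 : 0 ≤ X + algebraMap ℝ 𝔄 ‖X‖ := by
    rw [← neg_le_iff_add_nonneg']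
    exact neg_le.1 hX.neg_algebraMap_norm_le_self
  have h2 : 0 ≤ algebraMap ℝ 𝔄 ‖X‖ := algebraMap_nonneg _ (norm_nonneg X)
  have := (IsSelfAdjoint.of_nonneg (Φ.map_nonneg h1)).sub
    (IsSelfAdjoint.of_nonneg (Φ.map_nonneg h2))
  simpa using this

theorem PositiveLinearMap.norm_map_cfc_le (Φ : 𝔄 →ₚ[ℂ] 𝔅) {X : 𝔄} {g : ℝ → ℝ}
    (hg : ContinuousOn g (spectrum ℝ X)) (hX : IsSelfAdjoint X) {ε : ℝ} (hε : 0 ≤ ε)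
    (h : ∀ x ∈ spectrum ℝ X, |g x| ≤ ε) : ‖Φ (cfc g X)‖ ≤ ε * ‖Φ 1‖ := by
  have hsa : IsSelfAdjoint (cfc g X) := cfc_predicate g X
  have h1 : cfc g X ≤ algebraMap ℝ 𝔄 ε := by
    rw [← cfc_const ε X]
    exact cfc_mono fun x hx => (abs_le.1 (h x hx)).2
  have h2 : -algebraMap ℝ 𝔄 ε ≤ cfc g X := by
    rw [← map_neg, ← cfc_const (-ε) X]
    exact cfc_mono fun x hx => (abs_le.1 (h x hx)).1
  have h3 := norm_le_norm_of_neg_le_of_le (Φ.map_isSelfAdjoint hsa) (b := Φ (algebraMap ℝ 𝔄 ε))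
    (by rw [← map_neg]; exact Φ.monotone' h2) (Φ.monotone' h1)
  rwa [Φ.map_algebraMap_real, norm_smul, Real.norm_of_nonneg hε] at h3

end PositiveMap

/-! ### The Jensen inequality for integrals of positive maps -/

/-- Dominated convergence for approximations that are good on sets `S n`, which eventually contain
each point, and are a fixed multiple of an integrable function off `S n`. -/
theorem tendsto_integral_of_norm_sub_le {T E : Type*} [MeasurableSpace T] {ν : Measure T}
    [NormedAddCommGroup E] [NormedSpace ℝ E] {F : ℕ → T → E} {G N : T → E}
    {S : ℕ → Set T} {c : ℝ} (hG : Integrable G ν) (hN : Integrable N ν)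
    (hF : ∀ n, AEStronglyMeasurable (F n) ν) (hS : ∀ t, ∀ᶠ n in atTop, t ∈ S n)
    (h₁ : ∀ n, ∀ t ∈ S n, ‖G t - F n t‖ ≤ 1 / ((n : ℝ) + 1) * ‖N t‖)
    (h₂ : ∀ n, ∀ t ∉ S n, F n t = c • N t) :
    Tendsto (fun n => ∫ t, F n t ∂ν) atTop (𝓝 (∫ t, G t ∂ν)) := by
  refine tendsto_integral_of_dominated_convergence (fun t => ‖G t‖ + (1 + |c|) * ‖N t‖) hF
    (hG.norm.add (hN.norm.const_mul _)) (fun n => ae_of_all _ fun t => ?_)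
    (ae_of_all _ fun t => ?_)
  · by_cases ht : t ∈ S n
    · have h3 : ‖F n t‖ ≤ ‖G t‖ + ‖G t - F n t‖ := by
        simpa using norm_sub_le (G t) (G t - F n t)
      have h4 : 1 / ((n : ℝ) + 1) ≤ 1 := by
        rw [div_le_one (by positivity)]; linarith [(n.cast_nonneg : (0 : ℝ) ≤ n)]
      have h5 := h₁ n t ht
      nlinarith [norm_nonneg (N t), mul_nonneg (abs_nonneg c) (norm_nonneg (N t))]
    · rw [h₂ n t ht, norm_smul, Real.norm_eq_abs]
      nlinarith [norm_nonneg (N t), norm_nonneg (G t)]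
  · rw [tendsto_iff_norm_sub_tendsto_zero]
    have h0 : Tendsto (fun n : ℕ => 1 / ((n : ℝ) + 1) * ‖N t‖) atTop (𝓝 0) := by
      simpa using tendsto_one_div_add_atTop_nhds_zero_nat.mul_const ‖N t‖
    refine squeeze_zero' (Eventually.of_forall fun n => norm_nonneg _) ?_ h0
    filter_upwards [hS t] with n hn
    rw [norm_sub_rev]
    exact h₁ n t hn

theorem isSelfAdjoint_integral {T 𝔅 : Type*} [MeasurableSpace T] {ν : Measure T}
    [CStarAlgebra 𝔅] {F : T → 𝔅} (hF : ∀ t, IsSelfAdjoint (F t)) :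
    IsSelfAdjoint (∫ t, F t ∂ν) := by
  have h := (starL' ℝ : 𝔅 ≃L[ℝ] 𝔅).integral_comp_comm (μ := ν) F
  simp only [starL'_apply, fun t => (hF t).star_eq] at h
  exact h.symm

section Field

variable {𝔄 : Type*} [CStarAlgebra 𝔄] [PartialOrder 𝔄] [StarOrderedRing 𝔄]
  {K : Type v} [NormedAddCommGroup K] [InnerProductSpace ℂ K] [CompleteSpace K]
  {T : Type*} [TopologicalSpace T] [MeasurableSpace T] [OpensMeasurableSpace T] {ν : Measure T}
  {A : T → 𝔄} {Φ : T → 𝔄 →ₚ[ℂ] (K →L[ℂ] K)} {C Z : K →L[ℂ] K}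

theorem measurableSet_spectrum_subset_Icc (hA : Continuous A) (hAsa : ∀ t, IsSelfAdjoint (A t))
    (a b : ℝ) : MeasurableSet {t | spectrum ℝ (A t) ⊆ Icc a b} := by
  simp only [fun t => spectrum_subset_Icc_iff (hAsa t) (a := a) (b := b)]
  exact ((isClosed_le continuous_const hA).inter (isClosed_le hA continuous_const)).measurableSet

/-- If `Z` and all `A t` have positive spectrum, then `C* Z C + ∫ Φ_t(A_t)` is invertible, although
the lower bounds of the `A t` may tend to `0`. On the sets where `A t ≥ 1 / (n + 1)`, the integrals
of `Φ_t(1)` converge in norm, so for some `n` that part together with `C* C` is invertible. -/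
theorem isUnit_conj_add_integral_of_spectrum_pos (hA : Continuous A)
    (hAsa : ∀ t, IsSelfAdjoint (A t)) (hApos : ∀ t, ∀ x ∈ spectrum ℝ (A t), 0 < x)
    (h1 : Integrable (fun t => Φ t 1) ν) (hX : Integrable (fun t => Φ t (A t)) ν)
    (hZ : IsSelfAdjoint Z) (hZpos : ∀ x ∈ spectrum ℝ Z, 0 < x)
    (hsum : star C * C + ∫ t, Φ t 1 ∂ν = 1) :
    IsUnit (star C * Z * C + ∫ t, Φ t (A t) ∂ν) := by
  rcases subsingleton_or_nontrivial (K →L[ℂ] K) with hK | hK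
  · exact isUnit_of_subsingleton _
  have hpos1 : ∀ t, 0 ≤ Φ t 1 := fun t => (Φ t).map_nonneg zero_le_one
  have hpoint : ∀ t, ∃ r > 0, algebraMap ℝ 𝔄 r ≤ A t := by
    intro t
    -- A compact set of positive numbers has a positive lower bound.
    rcases subsingleton_or_nontrivial 𝔄 with h𝔄 | h𝔄
    · exact ⟨1, one_pos, (Subsingleton.elim _ _).le⟩
    · exact (CFC.exists_pos_algebraMap_le_iff (hAsa t)).2 (hApos t)
  obtain ⟨r, hr, hrZ⟩ := (CFC.exists_pos_algebraMap_le_iff hZ).2 hZpos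
  let S : ℕ → Set T := fun n => {t | algebraMap ℝ 𝔄 (1 / ((n : ℝ) + 1)) ≤ A t}
  have hSm : ∀ n, MeasurableSet (S n) := fun n =>
    (isClosed_le continuous_const hA).measurableSet
  have hSt : ∀ t, ∀ᶠ n in atTop, t ∈ S n := by
    intro t
    obtain ⟨q, hq, hqA⟩ := hpoint t
    filter_upwards [tendsto_one_div_add_atTop_nhds_zero_nat.eventually (eventually_lt_nhds hq)]
      with n hn
    exact (algebraMap_mono 𝔄 hn.le).trans hqA
  -- The approximations are exact on `S n` and vanish elsewhere.
  have hconv : Tendsto (fun n => ∫ t, (S n).indicator (fun t => Φ t 1) t ∂ν) atTop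
      (𝓝 (∫ t, Φ t 1 ∂ν)) := by
    refine tendsto_integral_of_norm_sub_le (S := S) (c := 0) h1 h1
      (fun n => h1.aestronglyMeasurable.indicator (hSm n)) hSt (fun n t ht => ?_) fun n t ht => ?_
    · rw [indicator_of_mem ht, sub_self, norm_zero]; positivity
    · rw [indicator_of_notMem ht, zero_smul]
  have hunit : ∀ᶠ n in atTop,
      IsUnit (star C * C + ∫ t, (S n).indicator (fun t => Φ t 1) t ∂ν) := by
    have h := hconv.const_add (star C * C)
    rw [hsum] at h
    exact h.eventually (Units.nhds (1 : (K →L[ℂ] K)ˣ))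
  obtain ⟨n, hn⟩ := hunit.exists
  have hint : Integrable ((S n).indicator fun t => Φ t 1) ν := h1.indicator (hSm n)
  have hnonneg : 0 ≤ ∫ t, (S n).indicator (fun t => Φ t 1) t ∂ν :=
    integral_nonneg fun t => indicator_nonneg (fun t _ => hpos1 t) t
  have hspos : IsStrictlyPositive (star C * C + ∫ t, (S n).indicator (fun t => Φ t 1) t ∂ν) :=
    hn.isStrictlyPositive (add_nonneg (star_mul_self_nonneg C) hnonneg)
  obtain ⟨ε, hε, hεr, hεn⟩ : ∃ ε > 0, ε ≤ r ∧ ε ≤ 1 / ((n : ℝ) + 1) :=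
    ⟨min r (1 / ((n : ℝ) + 1)), lt_min hr (by positivity), min_le_left _ _, min_le_right _ _⟩
  refine CStarAlgebra.isUnit_of_le
    (ε • (star C * C + ∫ t, (S n).indicator (fun t => Φ t 1) t ∂ν)) ?_ (hspos.smul hε)
  rw [smul_add]
  refine add_le_add ?_ ?_
  · have := star_left_conjugate_le_conjugate ((algebraMap_mono (K →L[ℂ] K) hεr).trans hrZ) C
    simpa [Algebra.algebraMap_eq_smul_one] using this
  · rw [← integral_smul]
    refine integral_mono (hint.smul ε) hX fun t => ?_
    by_cases ht : t ∈ S n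
    · simp only [indicator_of_mem ht]
      rw [← (Φ t).map_algebraMap_real]
      exact (Φ t).monotone' ((algebraMap_mono 𝔄 hεn).trans ht)
    · simp only [indicator_of_notMem ht, smul_zero]
      obtain ⟨q, hq, hqA⟩ := hpoint t
      exact (Φ t).map_nonneg ((algebraMap_nonneg 𝔄 hq.le).trans hqA)

/-- A point `c ∉ J` lies on one side of `J`, so that `c - A t` or `A t - c` has positive spectrum
for all `t`. -/
theorem spectrum_conj_add_integral_subset {J : Set ℝ} (hJ : J.OrdConnected) (hA : Continuous A)
    (hAsa : ∀ t, IsSelfAdjoint (A t)) (hAJ : ∀ t, spectrum ℝ (A t) ⊆ J)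
    (h1 : Integrable (fun t => Φ t 1) ν) (hX : Integrable (fun t => Φ t (A t)) ν)
    (hZ : IsSelfAdjoint Z) (hZJ : spectrum ℝ Z ⊆ J)
    (hsum : star C * C + ∫ t, Φ t 1 ∂ν = 1) :
    spectrum ℝ (star C * Z * C + ∫ t, Φ t (A t) ∂ν) ⊆ J := by
  intro c hc
  by_contra hcJ
  have hsc : ∀ c : ℝ, star C * algebraMap ℝ (K →L[ℂ] K) c * C + c • ∫ t, Φ t 1 ∂ν =
      algebraMap ℝ (K →L[ℂ] K) c := by
    intro c
    rw [Algebra.algebraMap_eq_smul_one, mul_smul_comm, smul_mul_assoc, mul_one, ← smul_add, hsum]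
  have hside : (∀ x ∈ J, x < c) ∨ ∀ x ∈ J, c < x := by
    by_contra! h
    obtain ⟨⟨x, hx, hxc⟩, y, hy, hyc⟩ := h
    exact hcJ (hJ.out hy hx ⟨hyc, hxc⟩)
  have h1c : Integrable (fun t => c • Φ t 1) ν := h1.smul c
  rcases hside with h | h
  · refine hc ?_
    have := isUnit_conj_add_integral_of_spectrum_pos (ν := ν) (Φ := Φ) (C := C)
      (A := fun t => algebraMap ℝ 𝔄 c - A t)
      (Z := algebraMap ℝ _ c - Z) (continuous_const.sub hA)
      (fun t => (IsSelfAdjoint.algebraMap _ (IsSelfAdjoint.all c)).sub (hAsa t)) ?_ h1 ?_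
      ((IsSelfAdjoint.algebraMap _ (IsSelfAdjoint.all c)).sub hZ) ?_ hsum
    · change IsUnit (algebraMap ℝ (K →L[ℂ] K) c - _)
      convert this using 1
      simp only [map_sub, (Φ _).map_algebraMap_real]
      rw [integral_sub h1c hX, integral_smul]
      simp only [mul_sub, sub_mul]
      refine eq_of_sub_eq_zero (Eq.trans ?_ (sub_eq_zero.2 (hsc c).symm))
      abel
    · intro t x hx
      rw [← spectrum.singleton_sub_eq] at hx
      obtain ⟨_, rfl, y, hy, rfl⟩ := hx
      exact sub_pos.2 (h y (hAJ t hy))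
    · simp only [map_sub, (Φ _).map_algebraMap_real]
      exact h1c.sub hX
    · intro x hx
      rw [← spectrum.singleton_sub_eq] at hx
      obtain ⟨_, rfl, y, hy, rfl⟩ := hx
      exact sub_pos.2 (h y (hZJ hy))
  · refine hc ?_
    change IsUnit (algebraMap ℝ (K →L[ℂ] K) c - _)
    rw [IsUnit.sub_iff]
    have := isUnit_conj_add_integral_of_spectrum_pos (ν := ν) (Φ := Φ) (C := C)
      (A := fun t => A t - algebraMap ℝ 𝔄 c)
      (Z := Z - algebraMap ℝ _ c) (hA.sub continuous_const)
      (fun t => (hAsa t).sub (IsSelfAdjoint.algebraMap _ (IsSelfAdjoint.all c))) ?_ h1 ?_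
      (hZ.sub (IsSelfAdjoint.algebraMap _ (IsSelfAdjoint.all c))) ?_ hsum
    · convert this using 1
      simp only [map_sub, (Φ _).map_algebraMap_real]
      rw [integral_sub hX h1c, integral_smul]
      simp only [mul_sub, sub_mul]
      refine eq_of_sub_eq_zero (Eq.trans ?_ (sub_eq_zero.2 (hsc c)))
      abel
    · intro t x hx
      rw [← spectrum.sub_singleton_eq] at hx
      obtain ⟨y, hy, _, rfl, rfl⟩ := hx
      exact sub_pos.2 (h y (hAJ t hy))
    · simp only [map_sub, (Φ _).map_algebraMap_real]
      exact hX.sub h1c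
    · intro x hx
      rw [← spectrum.sub_singleton_eq] at hx
      obtain ⟨y, hy, _, rfl, rfl⟩ := hx
      exact sub_pos.2 (h y (hZJ hy))

/-- A family `t ↦ (Φ t, A t)` is approximated by finitely many positive integrable functions `B o`
with sum `Φ t 1` and nodes `x o`. The index `some i` belongs to a function of a partition of unity
on `[a, b]`, used where `A t` has its spectrum in `[a, b]`; the index `none` collects the
remaining `t`, with the node `x₀`. -/
theorem exists_field_discretization {J : Set ℝ} {f : ℝ → ℝ} (hf : ContinuousOn f J)
    (hA : Continuous A) (hAsa : ∀ t, IsSelfAdjoint (A t))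
    (hmeas : ∀ B : T → 𝔄, Continuous B → AEStronglyMeasurable (fun t => Φ t (B t)) ν)
    (h1 : Integrable (fun t => Φ t 1) ν) {a b : ℝ} (hab : Icc a b ⊆ J) {x₀ : ℝ} (hx₀ : x₀ ∈ J)
    {ε : ℝ} (hε : 0 < ε) :
    ∃ (m : ℕ) (x : Option (Fin m) → ℝ) (B : Option (Fin m) → T → K →L[ℂ] K),
      (∀ o, x o ∈ J) ∧ (∀ o t, 0 ≤ B o t) ∧ (∀ o, Integrable (B o) ν) ∧
      (∀ t, ∑ o, B o t = Φ t 1) ∧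
      (∀ t, spectrum ℝ (A t) ⊆ Icc a b →
        ‖Φ t (A t) - ∑ o, x o • B o t‖ ≤ ε * ‖Φ t 1‖ ∧
        ‖Φ t (cfc f (A t)) - ∑ o, f (x o) • B o t‖ ≤ ε * ‖Φ t 1‖) ∧
      (∀ t, ¬ spectrum ℝ (A t) ⊆ Icc a b →
        ∑ o, x o • B o t = x₀ • Φ t 1 ∧ ∑ o, f (x o) • B o t = f x₀ • Φ t 1) := by
  obtain ⟨m, x, φ, hx, hφ, hφ1, hφε⟩ := exists_partition_approx (hf.mono hab) hε
  let S : Set T := {t | spectrum ℝ (A t) ⊆ Icc a b}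
  have hS : MeasurableSet S := measurableSet_spectrum_subset_Icc hA hAsa a b
  have hsum : ∀ (c : Fin m → ℝ) t,
      Φ t (cfc (fun y => ∑ i, c i * φ i y) (A t)) = ∑ i, c i • Φ t (cfc (φ i) (A t)) := by
    intro c t
    have e : (fun y => ∑ i, c i * φ i y) = ∑ i, fun y => c i • φ i y := by
      ext y; simp
    rw [e, cfc_sum _ _ _ (fun i _ => by fun_prop), map_sum]
    refine Finset.sum_congr rfl fun i _ => ?_
    rw [cfc_smul _ _ _ (by fun_prop), (Φ t).map_smul_of_tower]
  have hsum1 : ∀ t ∈ S, ∑ i, Φ t (cfc (φ i) (A t)) = Φ t 1 := by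
    intro t ht
    have h := hsum (fun _ => 1) t
    simp only [one_mul, one_smul] at h
    rw [← h]
    congr 1
    rw [← cfc_const_one ℝ (A t)]
    exact cfc_congr fun y hy => hφ1 y (ht hy)
  have hpos : ∀ i t, 0 ≤ Φ t (cfc (φ i) (A t)) := fun i t =>
    (Φ t).map_nonneg (cfc_nonneg fun y _ => hφ i y)
  refine ⟨m, fun o => o.elim x₀ x, fun o => o.elim (Sᶜ.indicator fun t => Φ t 1)
    fun i => S.indicator fun t => Φ t (cfc (φ i) (A t)), ?_, ?_, ?_, ?_, ?_, ?_⟩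
  · rintro (_ | i)
    exacts [hx₀, hab (hx i)]
  · rintro (_ | i) t
    · exact indicator_nonneg (fun t _ => (Φ t).map_nonneg zero_le_one) t
    · exact indicator_nonneg (fun t _ => hpos i t) t
  · rintro (_ | i)
    · exact h1.indicator hS.compl
    · refine h1.mono ((hmeas _ ?_).indicator hS) (ae_of_all _ fun t => ?_)
      · exact hA.cfc_of_mem_nhdsSet (s := univ) (φ i) univ_mem hAsa (φ i).continuous.continuousOn
      · simp only [Option.elim]
        by_cases ht : t ∈ S
        · rw [indicator_of_mem ht]
          refine CStarAlgebra.norm_le_norm_of_nonneg_of_le (hpos i t) ?_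
          rw [← hsum1 t ht]
          exact Finset.single_le_sum (f := fun i => Φ t (cfc (φ i) (A t)))
            (fun j _ => hpos j t) (Finset.mem_univ i)
        · rw [indicator_of_notMem ht, norm_zero]; exact norm_nonneg _
  · intro t
    rw [Fintype.sum_option]
    by_cases ht : t ∈ S
    · simp [ht, hsum1 t ht]
    · simp [ht]
  · intro t ht
    replace ht : t ∈ S := ht
    have hcont : ContinuousOn f (spectrum ℝ (A t)) := hf.mono (Subset.trans ht hab)
    simp only [Fintype.sum_option, Option.elim, indicator_of_mem ht,
      indicator_of_notMem (fun h : t ∈ Sᶜ => h ht), smul_zero, zero_add]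
    constructor
    · have e : Φ t (A t) - ∑ i, x i • Φ t (cfc (φ i) (A t)) =
          Φ t (cfc (fun y => y - ∑ i, x i * φ i y) (A t)) := by
        rw [cfc_sub _ _ _ (by fun_prop) (by fun_prop), map_sub, hsum, cfc_id' ℝ (A t)]
      rw [e]
      exact (Φ t).norm_map_cfc_le (by fun_prop) (hAsa t) hε.le fun y hy => (hφε y (ht hy)).1
    · have e : Φ t (cfc f (A t)) - ∑ i, f (x i) • Φ t (cfc (φ i) (A t)) =
          Φ t (cfc (fun y => f y - ∑ i, f (x i) * φ i y) (A t)) := by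
        rw [cfc_sub _ _ _ hcont (by fun_prop), map_sub, hsum]
      rw [e]
      exact (Φ t).norm_map_cfc_le (hcont.sub (by fun_prop)) (hAsa t) hε.le
        fun y hy => (hφε y (ht hy)).2
  · intro t ht
    replace ht : t ∉ S := ht
    simp [Fintype.sum_option, ht]

/-- The Jensen operator inequality for the combination of one conjugation and an integral of
positive maps. -/
theorem OperatorConvexOn.cfc_conj_add_integral_le {J : Set ℝ} {f : ℝ → ℝ}
    (hf : OperatorConvexOn.{v} J f) (hA : Continuous A)
    (hAsa : ∀ t, IsSelfAdjoint (A t)) (hAJ : ∀ t, spectrum ℝ (A t) ⊆ J)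
    (hmeas : ∀ B : T → 𝔄, Continuous B → AEStronglyMeasurable (fun t => Φ t (B t)) ν)
    (h1 : Integrable (fun t => Φ t 1) ν) (hX : Integrable (fun t => Φ t (A t)) ν)
    (hY : Integrable (fun t => Φ t (cfc f (A t))) ν)
    (hZ : IsSelfAdjoint Z) (hZJ : spectrum ℝ Z ⊆ J)
    (hsum : star C * C + ∫ t, Φ t 1 ∂ν = 1) :
    cfc f (star C * Z * C + ∫ t, Φ t (A t) ∂ν) ≤
      star C * cfc f Z * C + ∫ t, Φ t (cfc f (A t)) ∂ν := by
  rcases subsingleton_or_nontrivial (K →L[ℂ] K) with hK | hK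
  · exact (Subsingleton.elim _ _).le
  have hJne : J.Nonempty :=
    (ContinuousFunctionalCalculus.spectrum_nonempty (R := ℝ) Z hZ).mono hZJ
  obtain ⟨x₀, hx₀⟩ := hJne
  obtain ⟨a, b, -, habJ, hexh⟩ := exists_seq_Icc_exhausting hf.1 ⟨x₀, hx₀⟩
  choose m x B hxJ hB hBi hB1 hS hSc using fun n : ℕ =>
    exists_field_discretization hf.2.1 hA hAsa hmeas h1 (habJ n) hx₀
      (Nat.one_div_pos_of_nat (α := ℝ) (n := n))
  let S : ℕ → Set T := fun n => {t | spectrum ℝ (A t) ⊆ Icc (a n) (b n)}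
  have hSt : ∀ t, ∀ᶠ n in atTop, t ∈ S n := by
    intro t
    obtain ⟨c, d, hcd, hcdJ, hAcd⟩ := exists_Icc_of_isCompact_subset
      (spectrum.isCompact (A t)) hf.1 ⟨x₀, hx₀⟩ (hAJ t)
    filter_upwards [hexh c (hcdJ ⟨le_rfl, hcd⟩) d (hcdJ ⟨hcd, le_rfl⟩)] with n hn
    exact hAcd.trans hn
  have hBs : ∀ (g : ℝ → ℝ) n o, Integrable (fun t => g (x n o) • B n o t) ν :=
    fun g n o => (hBi n o).smul (g (x n o))
  have hint : ∀ (g : ℝ → ℝ) n, Integrable (fun t => ∑ o, g (x n o) • B n o t) ν := fun g n =>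
    integrable_finsetSum _ fun o _ => hBs g n o
  have hintsum : ∀ (g : ℝ → ℝ) n, ∫ t, ∑ o, g (x n o) • B n o t ∂ν =
      ∑ o, g (x n o) • ∫ t, B n o t ∂ν := by
    intro g n
    rw [integral_finsetSum _ fun o _ => hBs g n o]
    exact Finset.sum_congr rfl fun o _ => integral_smul _ _
  have hXlim : Tendsto (fun n => ∫ t, ∑ o, x n o • B n o t ∂ν) atTop (𝓝 (∫ t, Φ t (A t) ∂ν)) :=
    tendsto_integral_of_norm_sub_le (S := S) hX h1 (fun n => (hint id n).aestronglyMeasurable)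
      hSt (fun n t ht => (hS n t ht).1) (fun n t ht => (hSc n t ht).1)
  have hYlim : Tendsto (fun n => ∫ t, ∑ o, f (x n o) • B n o t ∂ν) atTop
      (𝓝 (∫ t, Φ t (cfc f (A t)) ∂ν)) :=
    tendsto_integral_of_norm_sub_le (S := S) hY h1 (fun n => (hint f n).aestronglyMeasurable)
      hSt (fun n t ht => (hS n t ht).2) (fun n t ht => (hSc n t ht).2)
  -- The integrals of the `B n o` are the weights of the finite inequality.
  have hpos : ∀ n o, 0 ≤ ∫ t, B n o t ∂ν := fun n o => integral_nonneg (hB n o)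
  have hone : ∀ n, star C * C + ∑ o, ∫ t, B n o t ∂ν = 1 := by
    intro n
    rw [← hsum, ← integral_finsetSum _ fun o _ => hBi n o]
    simp only [hB1]
  have hfin := fun n => hf.jensen_add_sum hZ hZJ (hpos n) (hxJ n) (hone n)
  have hCZ : IsSelfAdjoint (star C * Z * C) := hZ.conjugate' C
  have hlim := tendsto_cfc_of_spectrum_subset hf.1 hf.2.1 (hXlim.const_add (star C * Z * C))
    (fun n => ?_) (fun n => ?_) ?_ (spectrum_conj_add_integral_subset hf.1 hA hAsa hAJ h1 hX hZ
      hZJ hsum)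
  · refine le_of_tendsto_of_tendsto' hlim (hYlim.const_add (star C * cfc f Z * C)) fun n => ?_
    have := (hfin n).2
    rw [hintsum f n]
    have e := hintsum id n
    simp only [id] at e
    rw [e]
    exact this
  · have e := hintsum id n
    simp only [id] at e
    rw [e]
    exact hCZ.add (isSelfAdjoint_sum _ fun o _ =>
      (IsSelfAdjoint.all _).smul (IsSelfAdjoint.of_nonneg (hpos n o)))
  · have e := hintsum id n
    simp only [id] at e
    rw [e]
    exact (hfin n).1
  · refine hCZ.add ?_
    exact isSelfAdjoint_integral fun t => (Φ t).map_isSelfAdjoint (hAsa t)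

end Field

/-! ### Conjugation, continuity of fields, and perspectives of integrals -/

section Conjugation

variable {𝔅 : Type*} [CStarAlgebra 𝔅] [PartialOrder 𝔅] [StarOrderedRing 𝔅]

/-- The positive linear map `X ↦ C* X C`. -/
noncomputable def conjPositive (C : 𝔅) : 𝔅 →ₚ[ℂ] 𝔅 :=
  .mk₀ (LinearMap.mulLeftRight ℂ (star C, C)) fun _ hX => star_left_conjugate_nonneg hX C

theorem conjPositive_apply (C X : 𝔅) : conjPositive C X = star C * X * C := rfl

theorem rpow_half_mul_rpow_neg_half {R : 𝔅} (hR : IsStrictlyPositive R) :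
    R ^ (1 / 2 : ℝ) * R ^ (-(1 / 2) : ℝ) = 1 :=
  CFC.rpow_mul_rpow_neg _ hR

theorem rpow_neg_half_mul_rpow_half {R : 𝔅} (hR : IsStrictlyPositive R) :
    R ^ (-(1 / 2) : ℝ) * R ^ (1 / 2 : ℝ) = 1 :=
  CFC.rpow_neg_mul_rpow _ hR

theorem rpow_half_mul_rpow_half {R : 𝔅} (hR : 0 ≤ R) :
    R ^ (1 / 2 : ℝ) * R ^ (1 / 2 : ℝ) = R := by
  rw [← CFC.sqrt_eq_rpow, CFC.sqrt_mul_sqrt_self R hR]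

theorem star_rpow (R : 𝔅) (r : ℝ) : star (R ^ r) = R ^ r :=
  (IsSelfAdjoint.of_nonneg CFC.rpow_nonneg).star_eq

end Conjugation

theorem continuous_cfc_of_spectrum_subset {𝔄 : Type*} [CStarAlgebra 𝔄] {J : Set ℝ}
    (hJ : J.OrdConnected) {f : ℝ → ℝ} (hf : ContinuousOn f J) {T : Type*} [TopologicalSpace T]
    {A : T → 𝔄} (h : Continuous A) (hA : ∀ x, IsSelfAdjoint (A x))
    (hAJ : ∀ x, spectrum ℝ (A x) ⊆ J) : Continuous fun x => cfc f (A x) :=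
  continuous_iff_continuousAt.2 fun x =>
    tendsto_cfc_of_spectrum_subset hJ hf h.continuousAt hA hAJ (hA x) (hAJ x)

theorem continuous_rpow_of_isStrictlyPositive {𝔄 : Type*} [CStarAlgebra 𝔄] [PartialOrder 𝔄]
    [StarOrderedRing 𝔄] {T : Type*} [TopologicalSpace T] {R : T → 𝔄} (hR : Continuous R)
    (hpos : ∀ t, IsStrictlyPositive (R t)) (r : ℝ) : Continuous fun t => R t ^ r := by
  simp only [fun t => CFC.rpow_eq_cfc_real (a := R t) (y := r) (hpos t).nonneg]
  exact continuous_cfc_of_spectrum_subset (J := Ioi 0) ordConnected_Ioi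
    (fun x hx => (Real.continuousAt_rpow_const x r (Or.inl (ne_of_gt hx))).continuousWithinAt) hR
    (fun t => (hpos t).isSelfAdjoint) (fun t x hx => (hpos t).spectrum_pos hx)

/-- A bound of a positive map by its value at `1`; the factor `2` comes from splitting into real
and imaginary parts, and only local boundedness in `t` matters for its use. -/
theorem PositiveLinearMap.norm_apply_le {𝔄 𝔅 : Type*} [CStarAlgebra 𝔄] [PartialOrder 𝔄]
    [StarOrderedRing 𝔄] [CStarAlgebra 𝔅] [PartialOrder 𝔅] [StarOrderedRing 𝔅]
    (Φ : 𝔄 →ₚ[ℂ] 𝔅) (X : 𝔄) : ‖Φ X‖ ≤ 2 * ‖X‖ * ‖Φ 1‖ := by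
  have hsa : ∀ Y : 𝔄, IsSelfAdjoint Y → ‖Φ Y‖ ≤ ‖Y‖ * ‖Φ 1‖ := by
    intro Y hY
    have h := norm_le_norm_of_neg_le_of_le (Φ.map_isSelfAdjoint hY)
      (b := Φ (algebraMap ℝ 𝔄 ‖Y‖))
      (by rw [← map_neg]; exact Φ.monotone' hY.neg_algebraMap_norm_le_self)
      (Φ.monotone' hY.le_algebraMap_norm_self)
    rwa [Φ.map_algebraMap_real, norm_smul, norm_norm] at h
  have h1 := hsa _ (realPart X).2
  have h2 := hsa _ (imaginaryPart X).2
  have h3 : ‖((realPart X : selfAdjoint 𝔄) : 𝔄)‖ ≤ ‖X‖ := realPart.norm_le X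
  have h4 : ‖((imaginaryPart X : selfAdjoint 𝔄) : 𝔄)‖ ≤ ‖X‖ := imaginaryPart.norm_le X
  nth_rw 1 [← realPart_add_I_smul_imaginaryPart X]
  rw [map_add, map_smul]
  refine (norm_add_le _ _).trans ?_
  rw [norm_smul, Complex.norm_I, one_mul]
  nlinarith [norm_nonneg (Φ 1)]

/-- A pointwise continuous family of positive maps can be evaluated along a continuous field. -/
theorem continuous_positiveLinearMap_apply {𝔄 𝔅 : Type*} [CStarAlgebra 𝔄] [PartialOrder 𝔄]
    [StarOrderedRing 𝔄] [CStarAlgebra 𝔅] [PartialOrder 𝔅] [StarOrderedRing 𝔅]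
    {T : Type*} [TopologicalSpace T] {Φ : T → 𝔄 →ₚ[ℂ] 𝔅} (hΦ : ∀ X, Continuous fun t => Φ t X)
    {B : T → 𝔄} (hB : Continuous B) : Continuous fun t => Φ t (B t) := by
  refine continuous_iff_continuousAt.2 fun t₀ => ?_
  have e : (fun t => Φ t (B t)) = fun t => Φ t (B t - B t₀) + Φ t (B t₀) := by
    ext t; simp
  have h0 : Tendsto (fun t => Φ t (B t - B t₀)) (𝓝 t₀) (𝓝 0) := by
    refine squeeze_zero_norm (fun t => (Φ t).norm_apply_le _) ?_
    have : Continuous fun t => 2 * ‖B t - B t₀‖ * ‖Φ t 1‖ :=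
      (continuous_const.mul (hB.sub continuous_const).norm).mul (hΦ 1).norm
    simpa using this.tendsto t₀
  rw [e]
  simpa [ContinuousAt] using h0.add (hΦ (B t₀)).continuousAt.tendsto

/-- Neither space need be second countable: up to a null set the domain is a countable union of
compact sets, whose images are separable. -/
theorem Continuous.aestronglyMeasurable_of_regular {T E : Type*} [TopologicalSpace T] [T2Space T]
    [MeasurableSpace T] [BorelSpace T] {μ : Measure T} [IsFiniteMeasure μ] [μ.Regular]
    [TopologicalSpace E] [TopologicalSpace.PseudoMetrizableSpace E] {F : T → E}
    (hF : Continuous F) : AEStronglyMeasurable F μ := by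
  choose k hk hkc hkμ using fun n : ℕ => MeasurableSet.univ.exists_isCompact_sdiff_lt
    (measure_ne_top μ univ) (ENNReal.inv_ne_zero.2 (ENNReal.natCast_ne_top (n + 1)))
  have hnull : μ (⋃ n, k n)ᶜ = 0 := by
    refine le_antisymm (ge_of_tendsto' (x := atTop)
      ((tendsto_add_atTop_iff_nat 1).2 ENNReal.tendsto_inv_nat_nhds_zero) fun n => ?_) bot_le
    refine (measure_mono ?_).trans (hkμ n).le
    rw [compl_eq_univ_sdiff]
    exact sdiff_subset_sdiff_right (subset_iUnion k n)
  have h : AEStronglyMeasurable F (μ.restrict (⋃ n, k n)) :=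
    aestronglyMeasurable_iUnion_iff.2 fun n =>
      hF.continuousOn.aestronglyMeasurable_of_isCompact (hkc n) (hkc n).measurableSet
  rwa [Measure.restrict_eq_self_of_ae_mem] at h
  exact mem_ae_iff.2 hnull

/-- The supporting line at an interior point; without one, the interval has at most one point. -/
theorem ConvexOn.exists_affine_minorant {J : Set ℝ} {f : ℝ → ℝ} (hf : ConvexOn ℝ J f) :
    ∃ α β : ℝ, ∀ x ∈ J, α * x + β ≤ f x := by
  rcases (interior J).eq_empty_or_nonempty with h | ⟨c, hc⟩
  · have hsub : J.Subsingleton := by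
      intro x hx y hy
      by_contra hxy
      wlog hlt : x < y generalizing x y
      · exact this hy hx (Ne.symm hxy) (lt_of_le_of_ne (not_lt.1 hlt) (Ne.symm hxy))
      have : Ioo x y ⊆ interior J :=
        interior_maximal (Ioo_subset_Icc_self.trans (hf.1.ordConnected.out hx hy)) isOpen_Ioo
      obtain ⟨z, hz⟩ := nonempty_Ioo.2 hlt
      exact (h ▸ this hz : z ∈ (∅ : Set ℝ))
    rcases J.eq_empty_or_nonempty with rfl | ⟨x, hx⟩
    · exact ⟨0, 0, fun x hx => hx.elim⟩
    · exact ⟨0, f x, fun y hy => by rw [hsub hy hx]; simp⟩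
  · refine ⟨derivWithin f (Ioi c) c, f c - derivWithin f (Ioi c) c * c, fun x hx => ?_⟩
    rcases lt_trichotomy x c with hxc | rfl | hxc
    · have h1 := (hf.slope_le_leftDeriv_of_mem_interior hx hc hxc).trans
        (hf.leftDeriv_le_rightDeriv_of_mem_interior hc)
      rw [slope_def_field, div_le_iff₀ (sub_pos.2 hxc)] at h1
      linarith
    · linarith
    · have h1 := hf.rightDeriv_le_slope_of_mem_interior hc hx hxc
      rw [slope_def_field, le_div_iff₀ (sub_pos.2 hxc)] at h1
      linarith

/-- Operator convexity for multiples of the identity of a nonzero space is convexity. -/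
theorem OperatorConvexOn.convexOn {J : Set ℝ} {f : ℝ → ℝ} (hf : OperatorConvexOn.{v} J f)
    (K : Type v) [NormedAddCommGroup K] [InnerProductSpace ℂ K] [CompleteSpace K]
    [Nontrivial (K →L[ℂ] K)] : ConvexOn ℝ J f := by
  refine ⟨hf.1.convex, fun x hx y hy a b ha hb hab => ?_⟩
  obtain rfl : b = 1 - a := by linarith
  have hsp : ∀ z ∈ J, spectrum ℝ (algebraMap ℝ (K →L[ℂ] K) z) ⊆ J := fun z hz => by
    simpa [spectrum.scalar_eq] using hz
  have h := hf.2.2 K (algebraMap ℝ _ x) (algebraMap ℝ _ y)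
    (IsSelfAdjoint.algebraMap _ (IsSelfAdjoint.all x))
    (IsSelfAdjoint.algebraMap _ (IsSelfAdjoint.all y)) (hsp x hx) (hsp y hy) a
    ⟨ha, by linarith⟩
  have e : ∀ p q : ℝ, a • algebraMap ℝ (K →L[ℂ] K) p + (1 - a) • algebraMap ℝ (K →L[ℂ] K) q =
      algebraMap ℝ (K →L[ℂ] K) (a • p + (1 - a) • q) := fun p q => by
    simp [Algebra.smul_def]
  rw [e, cfc_algebraMap, cfc_algebraMap, cfc_algebraMap, e] at h
  rw [algebraMap_le_iff_le_spectrum (ha := IsSelfAdjoint.algebraMap _ (IsSelfAdjoint.all _))] at h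
  exact h _ (by rw [spectrum.scalar_eq]; rfl)

section Perspective

variable {K : Type v} [NormedAddCommGroup K] [InnerProductSpace ℂ K] [CompleteSpace K]

theorem compress_eq_conjPositive (L R : K →L[ℂ] K) :
    compress L R = conjPositive (R ^ (-(1 / 2) : ℝ)) L := by
  rw [conjPositive_apply, star_rpow, compress]

theorem perspective_eq_conjPositive (f : ℝ → ℝ) (L R : K →L[ℂ] K) :
    perspective f L R = conjPositive (R ^ (1 / 2 : ℝ)) (cfc f (compress L R)) := by
  rw [conjPositive_apply, star_rpow, perspective]

theorem conjPositive_half_neg_half {R : K →L[ℂ] K} (hR : IsStrictlyPositive R) (L : K →L[ℂ] K) :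
    conjPositive (R ^ (1 / 2 : ℝ)) (conjPositive (R ^ (-(1 / 2) : ℝ)) L) = L := by
  simp only [conjPositive_apply, star_rpow]
  rw [mul_assoc, mul_assoc, rpow_neg_half_mul_rpow_half hR, ← mul_assoc, ← mul_assoc,
    rpow_half_mul_rpow_neg_half hR, one_mul, mul_one]

theorem conjPositive_half_compress {R : K →L[ℂ] K} (hR : IsStrictlyPositive R) (L : K →L[ℂ] K) :
    conjPositive (R ^ (1 / 2 : ℝ)) (compress L R) = L := by
  rw [compress_eq_conjPositive, conjPositive_half_neg_half hR]

theorem conjPositive_neg_half_self {R : K →L[ℂ] K} (hR : IsStrictlyPositive R) :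
    conjPositive (R ^ (-(1 / 2) : ℝ)) R = 1 := by
  rw [conjPositive_apply, star_rpow, CFC.conjugate_rpow_neg_one_half R hR]

theorem conjPositive_half_one {R : K →L[ℂ] K} (hR : 0 ≤ R) :
    conjPositive (R ^ (1 / 2 : ℝ)) 1 = R := by
  rw [conjPositive_apply, star_rpow, mul_one, rpow_half_mul_rpow_half hR]

theorem isSelfAdjoint_compress {L : K →L[ℂ] K} (hL : IsSelfAdjoint L) (R : K →L[ℂ] K) :
    IsSelfAdjoint (compress L R) := by
  rw [compress_eq_conjPositive]
  exact (conjPositive _).map_isSelfAdjoint hL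

end Perspective

theorem integral_conjPositive {K : Type*} [NormedAddCommGroup K] [InnerProductSpace ℂ K]
    [CompleteSpace K] {T : Type*} [MeasurableSpace T] {ν : Measure T} {F : T → K →L[ℂ] K} (hF : Integrable F ν) (C : K →L[ℂ] K) :
    Integrable (fun t => conjPositive C (F t)) ν ∧
      ∫ t, conjPositive C (F t) ∂ν = conjPositive C (∫ t, F t ∂ν) :=
  ⟨(ContinuousLinearMap.mulLeftRight ℝ (K →L[ℂ] K) (star C) C).integrable_comp hF,
    (ContinuousLinearMap.mulLeftRight ℝ (K →L[ℂ] K) (star C) C).integral_comp_comm hF⟩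

/-- If `J` is empty, then `T` is empty or `𝔄` is trivial, so that every `Φ t 1` vanishes. -/
theorem nonempty_of_integral_ne_zero {𝔄 : Type*} [CStarAlgebra 𝔄] [PartialOrder 𝔄]
    {K : Type*} [NormedAddCommGroup K] [InnerProductSpace ℂ K]
    {T : Type*} [MeasurableSpace T] {ν : Measure T} {A : T → 𝔄} {Φ : T → 𝔄 →ₚ[ℂ] (K →L[ℂ] K)}
    {J : Set ℝ} (hAsa : ∀ t, IsSelfAdjoint (A t))
    (hAJ : ∀ t, spectrum ℝ (A t) ⊆ J) (h : ∫ t, Φ t 1 ∂ν ≠ 0) : J.Nonempty := by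
  by_contra hJ
  rw [not_nonempty_iff_eq_empty] at hJ
  refine h ?_
  rw [← integral_zero T (K →L[ℂ] K) (μ := ν)]
  congr 1
  ext1 t
  rcases subsingleton_or_nontrivial 𝔄 with h𝔄 | h𝔄
  · rw [Subsingleton.elim (1 : 𝔄) 0, map_zero]
  · have := (ContinuousFunctionalCalculus.spectrum_nonempty (R := ℝ) (A t) (hAsa t)).mono (hAJ t)
    simp [hJ] at this

theorem isStrictlyPositive_integral_one {𝔄 : Type*} [CStarAlgebra 𝔄] [PartialOrder 𝔄]
    [StarOrderedRing 𝔄] {K : Type*} [NormedAddCommGroup K] [InnerProductSpace ℂ K]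
    [CompleteSpace K] {T : Type*} [MeasurableSpace T] {ν : Measure T}
    {Φ : T → 𝔄 →ₚ[ℂ] (K →L[ℂ] K)} (hD : IsUnit (∫ t, Φ t 1 ∂ν)) :
    IsStrictlyPositive (∫ t, Φ t 1 ∂ν) :=
  hD.isStrictlyPositive (integral_nonneg fun t => (Φ t).map_nonneg zero_le_one)

section Field

variable {𝔄 : Type*} [CStarAlgebra 𝔄] [PartialOrder 𝔄] [StarOrderedRing 𝔄]
  {K : Type v} [NormedAddCommGroup K] [InnerProductSpace ℂ K] [CompleteSpace K]
  {T : Type*} [TopologicalSpace T] [MeasurableSpace T] [OpensMeasurableSpace T] {ν : Measure T}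
  {A : T → 𝔄} {Φ : T → 𝔄 →ₚ[ℂ] (K →L[ℂ] K)}

theorem spectrum_integral_subset {J : Set ℝ} (hJ : J.OrdConnected) (hA : Continuous A)
    (hAsa : ∀ t, IsSelfAdjoint (A t)) (hAJ : ∀ t, spectrum ℝ (A t) ⊆ J)
    (h1 : Integrable (fun t => Φ t 1) ν) (hX : Integrable (fun t => Φ t (A t)) ν)
    (hsum : ∫ t, Φ t 1 ∂ν = 1) : spectrum ℝ (∫ t, Φ t (A t) ∂ν) ⊆ J := by
  rcases subsingleton_or_nontrivial (K →L[ℂ] K) with hK | hK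
  · rw [spectrum.of_subsingleton]; exact empty_subset _
  obtain ⟨x, hx⟩ := nonempty_of_integral_ne_zero hAsa hAJ (hsum.trans_ne one_ne_zero)
  simpa using spectrum_conj_add_integral_subset (C := 0) (Z := algebraMap ℝ _ x) hJ hA hAsa hAJ
    h1 hX (IsSelfAdjoint.algebraMap _ (IsSelfAdjoint.all x))
    (by simpa [spectrum.scalar_eq] using hx) (by simpa using hsum)

theorem OperatorConvexOn.cfc_integral_le {J : Set ℝ} {f : ℝ → ℝ}
    (hf : OperatorConvexOn.{v} J f) (hA : Continuous A)
    (hAsa : ∀ t, IsSelfAdjoint (A t)) (hAJ : ∀ t, spectrum ℝ (A t) ⊆ J)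
    (hmeas : ∀ B : T → 𝔄, Continuous B → AEStronglyMeasurable (fun t => Φ t (B t)) ν)
    (h1 : Integrable (fun t => Φ t 1) ν) (hX : Integrable (fun t => Φ t (A t)) ν)
    (hY : Integrable (fun t => Φ t (cfc f (A t))) ν) (hsum : ∫ t, Φ t 1 ∂ν = 1) :
    cfc f (∫ t, Φ t (A t) ∂ν) ≤ ∫ t, Φ t (cfc f (A t)) ∂ν := by
  rcases subsingleton_or_nontrivial (K →L[ℂ] K) with hK | hK
  · exact (Subsingleton.elim _ _).le
  obtain ⟨x, hx⟩ := nonempty_of_integral_ne_zero hAsa hAJ (hsum.trans_ne one_ne_zero)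
  simpa using hf.cfc_conj_add_integral_le (C := 0) (Z := algebraMap ℝ _ x) hA hAsa hAJ hmeas
    h1 hX hY (IsSelfAdjoint.algebraMap _ (IsSelfAdjoint.all x))
    (by simpa [spectrum.scalar_eq] using hx) (by simpa using hsum)

/-- The case of a family made unital by conjugation with `D^{-1/2}`, `D = ∫ Φ_t(1)`. -/
theorem spectrum_compress_integral_subset {J : Set ℝ} (hJ : J.OrdConnected) (hA : Continuous A)
    (hAsa : ∀ t, IsSelfAdjoint (A t)) (hAJ : ∀ t, spectrum ℝ (A t) ⊆ J)
    (h1 : Integrable (fun t => Φ t 1) ν) (hX : Integrable (fun t => Φ t (A t)) ν)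
    (hD : IsUnit (∫ t, Φ t 1 ∂ν)) :
    spectrum ℝ (compress (∫ t, Φ t (A t) ∂ν) (∫ t, Φ t 1 ∂ν)) ⊆ J := by
  have hDs := isStrictlyPositive_integral_one hD
  obtain ⟨h1i, h1e⟩ := integral_conjPositive h1 ((∫ t, Φ t 1 ∂ν) ^ (-(1 / 2) : ℝ))
  obtain ⟨hXi, hXe⟩ := integral_conjPositive hX ((∫ t, Φ t 1 ∂ν) ^ (-(1 / 2) : ℝ))
  rw [compress_eq_conjPositive, ← hXe]
  exact spectrum_integral_subset
    (Φ := fun t => (conjPositive ((∫ t, Φ t 1 ∂ν) ^ (-(1 / 2) : ℝ))).comp (Φ t)) hJ hA hAsa hAJ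
    h1i hXi (h1e.trans (conjPositive_neg_half_self hDs))

/-- The Jensen inequality in homogeneous form: the family is made unital by conjugation with
`D^{-1/2}`, `D = ∫ Φ_t(1)`, and the resulting inequality is conjugated back with `D^{1/2}`. -/
theorem OperatorConvexOn.perspective_integral_le {J : Set ℝ} {f : ℝ → ℝ}
    (hf : OperatorConvexOn.{v} J f) (hA : Continuous A)
    (hAsa : ∀ t, IsSelfAdjoint (A t)) (hAJ : ∀ t, spectrum ℝ (A t) ⊆ J)
    (hmeas : ∀ B : T → 𝔄, Continuous B → AEStronglyMeasurable (fun t => Φ t (B t)) ν)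
    (h1 : Integrable (fun t => Φ t 1) ν) (hX : Integrable (fun t => Φ t (A t)) ν)
    (hY : Integrable (fun t => Φ t (cfc f (A t))) ν) (hD : IsUnit (∫ t, Φ t 1 ∂ν)) :
    perspective f (∫ t, Φ t (A t) ∂ν) (∫ t, Φ t 1 ∂ν) ≤ ∫ t, Φ t (cfc f (A t)) ∂ν := by
  have hDs := isStrictlyPositive_integral_one hD
  obtain ⟨h1i, h1e⟩ := integral_conjPositive h1 ((∫ t, Φ t 1 ∂ν) ^ (-(1 / 2) : ℝ))
  obtain ⟨hXi, hXe⟩ := integral_conjPositive hX ((∫ t, Φ t 1 ∂ν) ^ (-(1 / 2) : ℝ))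
  obtain ⟨hYi, hYe⟩ := integral_conjPositive hY ((∫ t, Φ t 1 ∂ν) ^ (-(1 / 2) : ℝ))
  have key := hf.cfc_integral_le
    (Φ := fun t => (conjPositive ((∫ t, Φ t 1 ∂ν) ^ (-(1 / 2) : ℝ))).comp (Φ t)) hA hAsa hAJ
    (fun B hB => ((ContinuousLinearMap.mulLeftRight ℝ (K →L[ℂ] K) _ _).continuous
      |>.comp_aestronglyMeasurable (hmeas B hB))) h1i hXi hYi
    (h1e.trans (conjPositive_neg_half_self hDs))
  have h2 := (conjPositive ((∫ t, Φ t 1 ∂ν) ^ (1 / 2 : ℝ))).monotone' key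
  rw [perspective_eq_conjPositive, compress_eq_conjPositive, ← hXe]
  refine h2.trans (le_of_eq ?_)
  rw [← conjPositive_half_neg_half hDs (∫ t, Φ t (cfc f (A t)) ∂ν), ← hYe]
  rfl

end Field

/-! ### Integrability and integrals of perspectives -/

section PerspectiveField

variable {K : Type v} [NormedAddCommGroup K] [InnerProductSpace ℂ K] [CompleteSpace K]
  {T : Type*} [TopologicalSpace T] {L R : T → K →L[ℂ] K}

theorem continuous_compress (hL : Continuous L) (hR : Continuous R)
    (hpos : ∀ t, IsStrictlyPositive (R t)) : Continuous fun t => compress (L t) (R t) := by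
  have h := continuous_rpow_of_isStrictlyPositive hR hpos (-(1 / 2))
  exact (h.mul hL).mul h

theorem continuous_perspective {J : Set ℝ} (hJ : J.OrdConnected) {f : ℝ → ℝ}
    (hf : ContinuousOn f J) (hL : Continuous L) (hLsa : ∀ t, IsSelfAdjoint (L t))
    (hR : Continuous R) (hpos : ∀ t, IsStrictlyPositive (R t))
    (hJs : ∀ t, spectrum ℝ (compress (L t) (R t)) ⊆ J) :
    Continuous fun t => perspective f (L t) (R t) := by
  have h := continuous_rpow_of_isStrictlyPositive hR hpos (1 / 2)
  have hc := continuous_cfc_of_spectrum_subset hJ hf (continuous_compress hL hR hpos)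
    (fun t => isSelfAdjoint_compress (hLsa t) (R t)) hJs
  exact (h.mul hc).mul h

theorem le_perspective_of_affine_le {J : Set ℝ} {f : ℝ → ℝ} (hf : ContinuousOn f J) {α β : ℝ}
    (hαβ : ∀ x ∈ J, α * x + β ≤ f x) {L R : K →L[ℂ] K} (hL : IsSelfAdjoint L)
    (hR : IsStrictlyPositive R) (hJ : spectrum ℝ (compress L R) ⊆ J) :
    α • L + β • R ≤ perspective f L R := by
  have hsa := isSelfAdjoint_compress hL R
  have h : α • compress L R + β • 1 ≤ cfc f (compress L R) := by
    have e : cfc (fun x => α * x + β) (compress L R) = α • compress L R + β • 1 := by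
      rw [cfc_add_const β (fun x => α * x) _ (by fun_prop) hsa, cfc_const_mul_id α _ hsa,
        Algebra.algebraMap_eq_smul_one]
    rw [← e]
    exact cfc_mono (fun x hx => hαβ x (hJ hx)) (by fun_prop) (hf.mono hJ)
  have h' := (conjPositive (R ^ (1 / 2 : ℝ))).monotone' h
  rw [perspective_eq_conjPositive]
  refine le_trans (le_of_eq ?_) h'
  change _ = conjPositive (R ^ (1 / 2 : ℝ)) (α • compress L R + β • 1)
  rw [map_add, PositiveLinearMap.map_smul_of_tower, PositiveLinearMap.map_smul_of_tower,
    conjPositive_half_compress hR, conjPositive_half_one hR.nonneg]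

/-- The perspective is squeezed between `α L + β R`, for an affine minorant `α x + β` of `f`, and
`Y`; the norm of a positive operator is monotone. -/
theorem OperatorConvexOn.integrable_perspective [T2Space T] [MeasurableSpace T] [BorelSpace T]
    {μ : Measure T} [IsFiniteMeasure μ] [μ.Regular] {J : Set ℝ} {f : ℝ → ℝ}
    (hf : OperatorConvexOn.{v} J f) (hL : Continuous L) (hLsa : ∀ t, IsSelfAdjoint (L t))
    (hR : Continuous R) (hpos : ∀ t, IsStrictlyPositive (R t))
    (hJs : ∀ t, spectrum ℝ (compress (L t) (R t)) ⊆ J) (hLi : Integrable L μ)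
    (hRi : Integrable R μ) {Y : T → K →L[ℂ] K} (hYi : Integrable Y μ)
    (hY : ∀ t, perspective f (L t) (R t) ≤ Y t) :
    Integrable (fun t => perspective f (L t) (R t)) μ := by
  have hcont := continuous_perspective hf.1 hf.2.1 hL hLsa hR hpos hJs
  rcases subsingleton_or_nontrivial (K →L[ℂ] K) with hK | hK
  · rw [Subsingleton.elim (fun t => perspective f (L t) (R t)) 0]
    exact integrable_zero _ _ _
  obtain ⟨α, β, hαβ⟩ := (hf.convexOn K).exists_affine_minorant
  have hlow := fun t => le_perspective_of_affine_le hf.2.1 hαβ (hLsa t) (hpos t) (hJs t)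
  have hNi : Integrable (fun t => α • L t + β • R t) μ := (hLi.smul α).add (hRi.smul β)
  have hdiff : Integrable (fun t => perspective f (L t) (R t) - (α • L t + β • R t)) μ := by
    refine (hYi.sub hNi).mono (hcont.sub
      ((hL.const_smul α).add (hR.const_smul β))).aestronglyMeasurable_of_regular
      (ae_of_all _ fun t => ?_)
    exact CStarAlgebra.norm_le_norm_of_nonneg_of_le (sub_nonneg.2 (hlow t))
      (sub_le_sub_right (hY t) _)
  exact (hdiff.add hNi).congr (ae_of_all _ fun t => sub_add_cancel _ _)

/-- The perspective is subadditive under integration. It is the homogeneous Jensen inequality for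
the maps `Y ↦ R_t^{1/2} Y R_t^{1/2}`, which send `1` to `R_t`, the compression of `L_t` to `L_t`,
and its image under `f` to the perspective. -/
theorem OperatorConvexOn.perspective_integral_le_integral_perspective [T2Space T]
    [MeasurableSpace T] [BorelSpace T]
    {μ : Measure T} [IsFiniteMeasure μ] [μ.Regular] {J : Set ℝ} {f : ℝ → ℝ}
    (hf : OperatorConvexOn.{v} J f) (hL : Continuous L) (hLsa : ∀ t, IsSelfAdjoint (L t))
    (hR : Continuous R) (hpos : ∀ t, IsStrictlyPositive (R t))
    (hJs : ∀ t, spectrum ℝ (compress (L t) (R t)) ⊆ J) (hLi : Integrable L μ)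
    (hRi : Integrable R μ) (hi : Integrable (fun t => perspective f (L t) (R t)) μ) (S : Set T)
    (hD : IsUnit (∫ t in S, R t ∂μ)) :
    perspective f (∫ t in S, L t ∂μ) (∫ t in S, R t ∂μ) ≤
      ∫ t in S, perspective f (L t) (R t) ∂μ := by
  have hR1 : (fun t => conjPositive (R t ^ (1 / 2 : ℝ)) 1) = R :=
    funext fun t => conjPositive_half_one (hpos t).nonneg
  have hLc : (fun t => conjPositive (R t ^ (1 / 2 : ℝ)) (compress (L t) (R t))) = L :=
    funext fun t => conjPositive_half_compress (hpos t) (L t)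
  have hP : (fun t => conjPositive (R t ^ (1 / 2 : ℝ)) (cfc f (compress (L t) (R t)))) =
      fun t => perspective f (L t) (R t) :=
    funext fun t => (perspective_eq_conjPositive f (L t) (R t)).symm
  have hc := continuous_rpow_of_isStrictlyPositive hR hpos (1 / 2)
  have key := hf.perspective_integral_le (ν := μ.restrict S)
    (Φ := fun t => conjPositive (R t ^ (1 / 2 : ℝ))) (A := fun t => compress (L t) (R t))
    (continuous_compress hL hR hpos) (fun t => isSelfAdjoint_compress (hLsa t) (R t)) hJs
    (fun B hB => ((hc.star.mul hB).mul hc).aestronglyMeasurable_of_regular.restrict)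
    (by rw [hR1]; exact hRi.restrict) (by rw [hLc]; exact hLi.restrict)
    (by rw [hP]; exact hi.restrict) (by rw [hR1]; exact hD)
  rwa [hR1, hLc, hP] at key

end PerspectiveField

/-- For the order that a closed subalgebra inherits from the Loewner order, positive elements are
the squares: by spectral permanence, the square root can be taken inside the subalgebra. -/
theorem StarSubalgebra.starOrderedRing {H : Type*} [NormedAddCommGroup H] [InnerProductSpace ℂ H]
    [CompleteSpace H] (𝔄 : StarSubalgebra ℂ (H →L[ℂ] H)) [IsClosed (𝔄 : Set (H →L[ℂ] H))] :
    StarOrderedRing 𝔄 := by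
  refine StarOrderedRing.of_nonneg_iff' (fun {x y} h z => ?_) fun x => ⟨fun h => ?_, ?_⟩
  · exact add_le_add_right (α := H →L[ℂ] H) h z
  · have h0 : (0 : H →L[ℂ] H) ≤ x := h
    have hsa : IsSelfAdjoint x := Subtype.ext (IsSelfAdjoint.of_nonneg h0).star_eq
    have hspec : SpectrumRestricts x ContinuousMap.realToNNReal := by
      rw [SpectrumRestricts.nnreal_iff]
      intro c hc
      have hc' : c ∈ spectrum ℝ (x : H →L[ℂ] H) := by
        rw [← spectrum.preimage_algebraMap ℂ] at hc ⊢
        rwa [mem_preimage, ← StarSubalgebra.spectrum_eq (S := 𝔄)]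
      exact spectrum_nonneg_of_nonneg h0 hc'
    obtain ⟨s, hs, -, hss⟩ := CFC.exists_sqrt_of_isSelfAdjoint_of_quasispectrumRestricts hsa
      hspec
    exact ⟨s, by rw [hs.star_eq, hss]⟩
  · rintro ⟨s, rfl⟩
    exact star_mul_self_nonneg (s : H →L[ℂ] H)

/-- The inclusion of an algebra of operators, as a positive linear map. -/
noncomputable def StarSubalgebra.subtypePositive {K : Type*} [NormedAddCommGroup K] [InnerProductSpace ℂ K]
    [CompleteSpace K] (𝔅 : StarSubalgebra ℂ (K →L[ℂ] K)) : 𝔅 →ₚ[ℂ] (K →L[ℂ] K) where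
  toLinearMap := 𝔅.subtype.toAlgHom.toLinearMap
  monotone' := fun _ _ h => h

theorem theorem3p1 {H : Type*} {K : Type v} {T : Type*}
    [NormedAddCommGroup H] [InnerProductSpace ℂ H] [CompleteSpace H]
    [NormedAddCommGroup K] [InnerProductSpace ℂ K] [CompleteSpace K]
    (𝔄 : StarSubalgebra ℂ (H →L[ℂ] H)) [IsClosed (𝔄 : Set (H →L[ℂ] H))]
    (𝔅 : StarSubalgebra ℂ (K →L[ℂ] K)) [IsClosed (𝔅 : Set (K →L[ℂ] K))]
    [TopologicalSpace T] [LocallyCompactSpace T] [T2Space T]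
    [MeasurableSpace T] [BorelSpace T]
    (μ : Measure T) [IsFiniteMeasure μ] [μ.Regular]
    (T₁ T₂ : Set T) (hT₁ : MeasurableSet T₁) (hT₂ : MeasurableSet T₂)
    (hdisj : Disjoint T₁ T₂) (hunion : T₁ ∪ T₂ = univ)
    (J : Set ℝ) (f : ℝ → ℝ) (hf : OperatorConvexOn.{v} J f)
    (A : T → 𝔄) (hA : Continuous A) (hAsa : ∀ t, IsSelfAdjoint (A t))
    (hAJ : ∀ t, spectrum ℝ (A t) ⊆ J)
    (Φ : T → 𝔄 →ₚ[ℂ] 𝔅) (hΦ : IsUnitalField μ Φ)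
    (hint : Integrable (fun t => (Φ t (A t) : K →L[ℂ] K)) μ)
    (hintf : Integrable (fun t => (Φ t (cfc f (A t)) : K →L[ℂ] K)) μ)
    (D : Set T → K →L[ℂ] K) (hD : D = fun S => fieldIntegral μ Φ S fun _ => 1)
    (X : Set T → K →L[ℂ] K) (hX : X = fun S => fieldIntegral μ Φ S A)
    (Y : Set T → K →L[ℂ] K) (hY : Y = fun S => fieldIntegral μ Φ S fun t => cfc f (A t)) :
    -- every operator to which `f` is applied has its spectrum in `J`
    (spectrum ℝ (X univ) ⊆ J ∧
      (IsUnit (D T₁) → spectrum ℝ (compress (X T₁) (D T₁)) ⊆ J) ∧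
      (IsUnit (D T₂) → spectrum ℝ (compress (X T₂) (D T₂)) ⊆ J) ∧
      ∀ t, IsUnit (Φ t 1 : K →L[ℂ] K) →
        spectrum ℝ (compress (Φ t (A t) : K →L[ℂ] K) (Φ t 1 : K →L[ℂ] K)) ⊆ J) ∧
    -- part (i)
    ((IsUnit (D T₁) → IsUnit (D T₂) →
        cfc f (X univ) ≤ perspective f (X T₁) (D T₁) + perspective f (X T₂) (D T₂)) ∧
      ((∀ t, IsUnit (Φ t 1 : K →L[ℂ] K)) →
        Integrable (fun t => perspective f (Φ t (A t) : K →L[ℂ] K) (Φ t 1 : K →L[ℂ] K)) μ ∧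
        (IsUnit (D T₁) → IsUnit (D T₂) →
          perspective f (X T₁) (D T₁) + perspective f (X T₂) (D T₂) ≤
            ∫ t, perspective f (Φ t (A t) : K →L[ℂ] K) (Φ t 1 : K →L[ℂ] K) ∂μ) ∧
        ∫ t, perspective f (Φ t (A t) : K →L[ℂ] K) (Φ t 1 : K →L[ℂ] K) ∂μ ≤ Y univ)) ∧
    -- part (ii)
    (IsUnit (D T₁) →
      Y T₁ - perspective f (X T₁) (D T₁) ≤ Y univ - cfc f (X univ) ∧
      0 ≤ Y T₁ - perspective f (X T₁) (D T₁)) := by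
  have : StarOrderedRing 𝔄 := 𝔄.starOrderedRing
  let Ψ : T → 𝔄 →ₚ[ℂ] (K →L[ℂ] K) := fun t => 𝔅.subtypePositive.comp (Φ t)
  have hΨ : ∀ B : T → 𝔄, Continuous B → Continuous fun t => Ψ t (B t) := fun B hB =>
    continuous_positiveLinearMap_apply
      (fun a => continuous_subtype_val.comp (hΦ.continuous_apply a)) hB
  have hmeas : ∀ B : T → 𝔄, Continuous B → AEStronglyMeasurable (fun t => Ψ t (B t)) μ :=
    fun B hB => (hΨ B hB).aestronglyMeasurable_of_regular
  have h1 : Integrable (fun t => Ψ t 1) μ := hΦ.integrable_one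
  have hXi : Integrable (fun t => Ψ t (A t)) μ := hint
  have hYi : Integrable (fun t => Ψ t (cfc f (A t))) μ := hintf
  have hone : ∫ t, Ψ t 1 ∂μ = 1 := hΦ.integral_one
  replace hD : ∀ S, D S = ∫ t in S, Ψ t 1 ∂μ := fun S => congrFun hD S
  replace hX : ∀ S, X S = ∫ t in S, Ψ t (A t) ∂μ := fun S => congrFun hX S
  replace hY : ∀ S, Y S = ∫ t in S, Ψ t (cfc f (A t)) ∂μ := fun S => congrFun hY S
  have hsplit : ∀ F : T → K →L[ℂ] K, Integrable F μ →
      ∫ t in T₁, F t ∂μ + ∫ t in T₂, F t ∂μ = ∫ t, F t ∂μ := by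
    intro F hF
    rw [← setIntegral_union hdisj hT₂ hF.integrableOn hF.integrableOn, hunion, setIntegral_univ]
  have hXsplit : X T₁ + X T₂ = X univ := by
    rw [hX, hX, hX, hsplit _ hXi, setIntegral_univ]
  have hYsplit : Y T₁ + Y T₂ = Y univ := by
    rw [hY, hY, hY, hsplit _ hYi, setIntegral_univ]
  have hDsplit : D T₁ + D T₂ = 1 := by rw [hD, hD, hsplit _ h1, hone]
  have hXsa : ∀ S, IsSelfAdjoint (X S) := fun S => by
    rw [hX]
    exact isSelfAdjoint_integral fun t => (Ψ t).map_isSelfAdjoint (hAsa t)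
  have hDpos : ∀ S, IsUnit (D S) → IsStrictlyPositive (D S) := fun S hS => by
    rw [hD] at hS ⊢
    exact isStrictlyPositive_integral_one hS
  have hspecS : ∀ S, IsUnit (D S) → spectrum ℝ (compress (X S) (D S)) ⊆ J := by
    intro S hS
    rw [hD] at hS
    rw [hX, hD]
    exact spectrum_compress_integral_subset hf.1 hA hAsa hAJ h1.restrict hXi.restrict hS
  -- At a single `t`, the integral statements are applied to the point mass at `t`.
  have hspect : ∀ t, IsUnit (Ψ t 1) → spectrum ℝ (compress (Ψ t (A t)) (Ψ t 1)) ⊆ J := by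
    intro t ht
    have h := spectrum_compress_integral_subset (ν := Measure.dirac t) (Φ := Ψ) hf.1 hA hAsa hAJ
      (integrable_dirac (by finiteness)) (integrable_dirac (by finiteness))
      (by rwa [integral_dirac])
    rwa [integral_dirac, integral_dirac] at h
  have hperspS : ∀ S, IsUnit (D S) → perspective f (X S) (D S) ≤ Y S := by
    intro S hS
    rw [hD] at hS
    rw [hX, hD, hY]
    exact hf.perspective_integral_le hA hAsa hAJ (fun B hB => (hmeas B hB).restrict)
      h1.restrict hXi.restrict hYi.restrict hS
  have hperspt : ∀ t, IsUnit (Ψ t 1) →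
      perspective f (Ψ t (A t)) (Ψ t 1) ≤ Ψ t (cfc f (A t)) := by
    intro t ht
    have h := hf.perspective_integral_le (ν := Measure.dirac t) (Φ := Ψ) hA hAsa hAJ
      (fun B hB => aestronglyMeasurable_dirac)
      (integrable_dirac (by finiteness)) (integrable_dirac (by finiteness))
      (integrable_dirac (by finiteness)) (by rwa [integral_dirac])
    rwa [integral_dirac, integral_dirac, integral_dirac] at h
  have hhalf : ∀ S, IsUnit (D S) → star (D S ^ (1 / 2 : ℝ)) * D S ^ (1 / 2 : ℝ) = D S :=
    fun S hS => by rw [star_rpow, rpow_half_mul_rpow_half (hDpos S hS).nonneg]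
  refine ⟨⟨?_, hspecS T₁, hspecS T₂, hspect⟩, ⟨fun hD₁ hD₂ => ?_, fun hunit => ?_⟩,
    fun hD₁ => ⟨?_, sub_nonneg.2 (hperspS T₁ hD₁)⟩⟩
  · rw [hX, setIntegral_univ]
    exact spectrum_integral_subset hf.1 hA hAsa hAJ h1 hXi hone
  · have h := (hf.finite_jensen (C := ![D T₁ ^ (1 / 2 : ℝ), D T₂ ^ (1 / 2 : ℝ)])
      (X := ![compress (X T₁) (D T₁), compress (X T₂) (D T₂)]) ?_ ?_ ?_).2
    · simp only [Fin.sum_univ_two, Matrix.cons_val_zero, Matrix.cons_val_one,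
        ← conjPositive_apply, conjPositive_half_compress (hDpos T₁ hD₁),
        conjPositive_half_compress (hDpos T₂ hD₂), hXsplit] at h
      rwa [← perspective_eq_conjPositive, ← perspective_eq_conjPositive] at h
    · intro i
      fin_cases i
      exacts [isSelfAdjoint_compress (hXsa T₁) _, isSelfAdjoint_compress (hXsa T₂) _]
    · intro i
      fin_cases i
      exacts [hspecS T₁ hD₁, hspecS T₂ hD₂]
    · simp only [Fin.sum_univ_two, Matrix.cons_val_zero, Matrix.cons_val_one]
      rw [hhalf T₁ hD₁, hhalf T₂ hD₂, hDsplit]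
  · replace hunit : ∀ t, IsUnit (Ψ t 1) := hunit
    have hpos : ∀ t, IsStrictlyPositive (Ψ t 1) := fun t =>
      (hunit t).isStrictlyPositive ((Ψ t).map_nonneg zero_le_one)
    have hLsa : ∀ t, IsSelfAdjoint (Ψ t (A t)) := fun t => (Ψ t).map_isSelfAdjoint (hAsa t)
    have hpi : Integrable (fun t => perspective f (Ψ t (A t)) (Ψ t 1)) μ :=
      hf.integrable_perspective (hΨ A hA) hLsa (hΨ _ continuous_const) hpos
        (fun t => hspect t (hunit t)) hXi h1 hYi fun t => hperspt t (hunit t)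
    have hpS : ∀ S, IsUnit (D S) → perspective f (X S) (D S) ≤
        ∫ t in S, perspective f (Ψ t (A t)) (Ψ t 1) ∂μ := by
      intro S hS
      rw [hD] at hS
      rw [hX, hD]
      exact hf.perspective_integral_le_integral_perspective (hΨ A hA) hLsa
        (hΨ _ continuous_const) hpos (fun t => hspect t (hunit t)) hXi h1 hpi S hS
    refine ⟨hpi, fun hD₁ hD₂ => ?_, ?_⟩
    · exact (add_le_add (hpS T₁ hD₁) (hpS T₂ hD₂)).trans_eq (hsplit _ hpi)
    · rw [hY, setIntegral_univ]
      exact integral_mono hpi hYi fun t => hperspt t (hunit t)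
  · have h := hf.cfc_conj_add_integral_le (ν := μ.restrict T₂) (Φ := Ψ)
      (C := D T₁ ^ (1 / 2 : ℝ)) (Z := compress (X T₁) (D T₁)) hA hAsa hAJ
      (fun B hB => (hmeas B hB).restrict) h1.restrict hXi.restrict hYi.restrict
      (isSelfAdjoint_compress (hXsa T₁) _) (hspecS T₁ hD₁)
      (by rw [hhalf T₁ hD₁, ← hD, hDsplit])
    rw [← hX, ← hY, ← conjPositive_apply, ← conjPositive_apply,
      conjPositive_half_compress (hDpos T₁ hD₁), ← perspective_eq_conjPositive, hXsplit] at h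
    rw [← hYsplit, sub_le_sub_iff]
    calc Y T₁ + cfc f (X univ) ≤ Y T₁ + (perspective f (X T₁) (D T₁) + Y T₂) := by gcongr
      _ = Y T₁ + Y T₂ + perspective f (X T₁) (D T₁) := by abel
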